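/- **Construction A.** Let $1\le a\le b\le\tau$ be integers, put $\delta=b-a$ and $w=\tau+1$. Let $q\ge\tau+1$ be a prime power. *Channel and codes.* An erasure pattern, i.e. a set of erased times in $\{0,1,2,\dots\}$, is permitted by the delay-constrained sliding-window (DC-SW) channel with parameters $\{a,b,\tau,w\}$ if in every window of $w$ consecutive times the erased times either form a single burst (consecutive times) of length at most $b$, or are at most $a$ in number. A streaming code over a field $F$ with message length $k$ and packet length $n>k$ maps message packets $\underline s(t)\in F^k$, $t\ge 0$, to coded packets $\underline x(t)\in F^n$ consisting of $\underline s(t)$ followed by a parity packet $\underline p(t)\in F^{n-k}$ that is a function of $\underline s(0),\dots,\underline s(t)$; its rate is $k/n$. It is rate-optimal if, for every permitted erasure pattern, each $\underline s(t)$ is a function of the packets received up to time $t+\tau$, and its rate equals $\frac{\tau_{\mathrm{eff}}-a+1}{\tau_{\mathrm{eff}}+\delta+1}$, where $\tau_{\mathrm{eff}}=\min\{\tau,w-1\}$. The diagonal embedding of an $[n,k]$ linear code with systematic generator matrix $[I_k\ P]$ is the streaming code with $p_j(t)=\sum_{i=0}^{k-1}s_i(t-j-k+i)P_{i,j}$,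 where $s_i(u)=0$ for $u<0$. *Construction.* A matrix is Cauchy-like if all its square submatrices are non-singular. Let $C$ be a Cauchy-like $a\times(\tau+1-a)$ matrix over $\mathbb F_q$, let $\alpha\in\mathbb F_{q^2}\setminus\mathbb F_q$, and let $v_{i,j}\in\mathbb F_q$ for $0\le i\le\delta-1$, $b+i\le j\le\tau+i$. Let $H$ be the $b\times(\tau+\delta+1)$ matrix over $\mathbb F_{q^2}$ (rows and columns numbered from $0$) whose rows $\delta,\dots,b-1$ and columns $0,\dots,\tau$ form $[I_a\ C]$, whose rows $0,\dots,\delta-1$ and columns $0,\dots,\delta-1$ form $\alpha I_\delta$, with $H(i,j)=v_{i,j}$ for $0\le i\le\delta-1$, $b+i\le j\le\tau+i$, with $H(\delta,\tau+\delta)=1$ if $\delta>0$, and with all other entries zero. **Theorem.** 1. There is a Cauchy matrix $\left(\frac1{x_i-y_j}\right)$ of size $a\times(\tau+1-a)$ over $\mathbb F_q$, with all the $x_i$ and $y_j$ distinct, that is Cauchy-like. 2. For every such $C$ and $\alpha$ there is an assignment of the $v_{i,j}$ in $\mathbb F_q$ such that the code over $\mathbb F_{q^2}$ with parity-check matrix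 $H$ has a systematic generator matrix $[I_{\tau-a+1}\ P]$, and its diagonal embedding is a rate-optimal streaming code for the DC-SW channel with parameters $\{a,b,\tau,w=\tau+1\}$, of rate $\frac{\tau-a+1}{\tau-a+b+1}$. 3. If $\delta=1$, the same holds over $\mathbb F_q$ itself with any nonzero $\alpha\in\mathbb F_q$ in place of $\alpha\in\mathbb F_{q^2}\setminus\mathbb F_q$. 4. Consequently the field size is $O(\tau^2)$: there is an absolute constant $c$ such that for all $1\le a\le b\le\tau$ the construction in 2 yields a rate-optimal code over some field $\mathbb F_{q^2}$ with $q\ge\tau+1$ and $q^2\le c\,\tau^2$. If $b-a=1$ it is $O(\tau)$: there is an absolute constant $c$ such that the construction in 3 yields a rate-optimal code over some field $\mathbb F_q$ with $\tau+1\le q\le c\,\tau$. -/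

import Mathlib

namespace Streaming

/-- A streaming code over `F` which maps message packets of length `k` to coded packets of length
`n`. The parity packet at time `t` is a function of the message packets at times `0, …, t`. -/
structure StreamingCode (F : Type*) (k n : ℕ) where
  /-- Coded packets are strictly longer than message packets. -/
  k_lt_n : k < n
  /-- The parity packet at time `t`. -/
  parity : (t : ℕ) → (Fin (t + 1) → Fin k → F) → Fin (n - k) → F

namespace StreamingCode

variable {F : Type*} {k n : ℕ}

/-- The coded packet at time `t`: the message packet followed by the parity packet. -/
def codedPacket (S : StreamingCode F k n) (s : ℕ → Fin k → F) (t : ℕ) : Fin n → F := fun j =>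
  if h : (j : ℕ) < k then s t ⟨j, h⟩
  else S.parity t (fun u => s u) ⟨(j : ℕ) - k, by have := j.isLt; omega⟩

open Classical in
/-- The received packet at time `t` when the packets at the times in `E` are erased. -/
noncomputable def received (S : StreamingCode F k n) (E : Set ℕ) (s : ℕ → Fin k → F) (t : ℕ) :
    Option (Fin n → F) :=
  if t ∈ E then none else some (S.codedPacket s t)

/-- The rate `k / n`. -/
def rate (_S : StreamingCode F k n) : ℚ := (k : ℚ) / (n : ℚ)

end StreamingCode

/-- The set `E` of erased times is permitted by the sliding-window channel with parameters
`a, b, w`: in each window of `w` consecutive times the erasures form one burst (a set of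
consecutive times) of length at most `b`, or there are at most `a` of them. -/
def SWAdmissible (a b w : ℕ) (E : Set ℕ) : Prop :=
  ∀ i : ℕ,
    (∃ j l : ℕ, l ≤ b ∧ E ∩ Set.Ico i (i + w) = Set.Ico j (j + l)) ∨
      (E ∩ Set.Ico i (i + w)).ncard ≤ a

namespace StreamingCode

variable {F : Type*} {k n : ℕ}

/-- There is a decoder which, for every permitted erasure pattern and every message sequence,
outputs each message packet `s t` from the packets received up to time `t + τ`. -/
def Recovers (S : StreamingCode F k n) (a b τ w : ℕ) : Prop :=
  ∃ D : (t : ℕ) → (Fin (t + τ + 1) → Option (Fin n → F)) → Fin k → F,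
    ∀ (s : ℕ → Fin k → F) (E : Set ℕ), SWAdmissible a b w E →
      ∀ t : ℕ, D t (fun u => S.received E s u) = s t

/-- Rate-optimality for the delay-constrained sliding-window channel with parameters `a, b, τ, w`:
with `τ_eff = min τ (w - 1)`, the rate equals `(τ_eff - a + 1) / (τ_eff + (b - a) + 1)`, and the
code recovers from all permitted erasure patterns with delay `τ`. -/
def RateOptimal (S : StreamingCode F k n) (a b τ w : ℕ) : Prop :=
  S.rate = (((min τ (w - 1) : ℕ) : ℚ) - a + 1) / (((min τ (w - 1) : ℕ) : ℚ) + ((b : ℚ) - a) + 1) ∧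
    S.Recovers a b τ w

end StreamingCode

/-- The systematic generator matrix `[I_k P]`. -/
def systematicGenerator {F : Type*} [Zero F] [One F] {k n : ℕ} (P : Matrix (Fin k) (Fin (n - k)) F) :
    Matrix (Fin k) (Fin n) F :=
  Matrix.of fun i j =>
    if h : (j : ℕ) < k then (1 : Matrix (Fin k) (Fin k) F) i ⟨j, h⟩
    else P i ⟨(j : ℕ) - k, by have := j.isLt; omega⟩

/-- The linear block code with parity-check matrix `H`. -/
def blockCode {F : Type*} [Field F] {r n : ℕ} (H : Matrix (Fin r) (Fin n) F) :
    Submodule F (Fin n → F) :=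
  LinearMap.ker H.mulVecLin

/-- `S` is obtained by diagonally embedding the block code `C`: for a systematic generator matrix
`[I_k P]` of `C`,
`[p_0(t), p_1(t+1), …, p_{n-k-1}(t+n-k-1)] = [s_0(t-k), s_1(t-k+1), …, s_{k-1}(t-1)] P`,
that is, `p_j(t) = ∑_i s_i(t - j - k + i) P_{i,j}`, where message symbols at negative times are
zero. -/
def StreamingCode.IsDiagonalEmbedding {F : Type*} [Field F] {k n : ℕ} (S : StreamingCode F k n)
    (C : Submodule F (Fin n → F)) : Prop :=
  ∃ P : Matrix (Fin k) (Fin (n - k)) F,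
    Submodule.span F (Set.range (systematicGenerator P).row) = C ∧
      ∀ (t : ℕ) (s : Fin (t + 1) → Fin k → F) (j : Fin (n - k)),
        S.parity t s j = ∑ i : Fin k,
          (if (j : ℕ) + k ≤ t + i then
            s ⟨t + i - (j + k), by have := i.isLt; omega⟩ i else 0) * P i j

/-- Every square submatrix is non-singular. -/
def IsCauchyLike {F : Type*} [Field F] {p r : ℕ} (A : Matrix (Fin p) (Fin r) F) : Prop :=
  ∀ (m : ℕ) (f : Fin m → Fin p) (g : Fin m → Fin r), Function.Injective f → Function.Injective g →
    (A.submatrix f g).det ≠ 0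

/-- The Cauchy matrix with entries `1 / (x_i - y_j)`. -/
def cauchyMatrix {F : Type*} [Field F] {p r : ℕ} (x : Fin p → F) (y : Fin r → F) :
    Matrix (Fin p) (Fin r) F :=
  Matrix.of fun i j => (x i - y j)⁻¹

/-- The matrix `[I_a C]`. -/
def mdsBlock {K : Type*} [Field K] {a τ : ℕ} (C : Matrix (Fin a) (Fin (τ + 1 - a)) K) :
    Matrix (Fin a) (Fin (τ + 1)) K :=
  Matrix.of fun i j =>
    if h : (j : ℕ) < a then (1 : Matrix (Fin a) (Fin a) K) i ⟨j, h⟩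
    else C i ⟨(j : ℕ) - a, by have := j.isLt; omega⟩

/-- The parity-check matrix of the construction, with rows `0, …, b - 1`, columns `0, …, τ + δ` and
`δ = b - a`. Rows `δ, …, b - 1` hold `[I_a C]` in columns `0, …, τ`, and, when `δ > 0`, a `1` at
`(δ, τ + δ)`. Row `i < δ` holds `α` at `(i, i)` and `v i j` in columns `j = b + i, …, τ + i`. All
other entries are zero. Entries of `v` outside this range are not used. -/
def constructionA {K L : Type*} [Field K] [Field L] [Algebra K L] (a b τ : ℕ)
    (C : Matrix (Fin a) (Fin (τ + 1 - a)) K) (α : L) (v : ℕ → ℕ → K) :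
    Matrix (Fin b) (Fin (τ + 1 + (b - a))) L :=
  Matrix.of fun i j =>
    if hi : (i : ℕ) < b - a then
      if (j : ℕ) = i then α
      else if b + (i : ℕ) ≤ j ∧ (j : ℕ) ≤ τ + i then algebraMap K L (v i j)
      else 0
    else if hj : (j : ℕ) < τ + 1 then
      algebraMap K L (mdsBlock C ⟨(i : ℕ) - (b - a), by have := i.isLt; omega⟩ ⟨j, hj⟩)
    else if 0 < b - a ∧ (i : ℕ) = b - a ∧ (j : ℕ) = τ + (b - a) then 1
    else 0

/-- The block code with parity-check matrix `H`, employed as the diagonally embedded code, yields a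
streaming code that is rate-optimal for the channel with parameters `a, b, τ, w = τ + 1` and has
rate `(τ - a + 1) / (τ - a + b + 1)`. -/
def YieldsRateOptimal {F : Type*} [Field F] (a b τ : ℕ)
    (H : Matrix (Fin b) (Fin (τ + 1 + (b - a))) F) : Prop :=
  ∃ S : StreamingCode F (τ + 1 - a) (τ + 1 + (b - a)),
    S.IsDiagonalEmbedding (blockCode H) ∧ S.RateOptimal a b τ (τ + 1) ∧
      S.rate = ((τ : ℚ) - a + 1) / ((τ : ℚ) - a + b + 1)

end Streaming

namespace Streaming

/-! ### Cauchy matrices and the MDS property of `[I C]` -/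

section CauchyLike
variable {F : Type*} [Field F] {p r : ℕ}

/-! Write `δ = b - a`. Since the embedding is linear and runs along diagonals, two message sequences
that agree before time `t` and look alike through the channel differ, along a diagonal, by a
codeword that vanishes before position `i` and, from there to position `i + τ`, is nonzero only at
erased times. So it suffices that such a codeword has `c i = 0` whenever the possible nonzero
positions lie in a burst of length `b` or number at most `a` (`StreamingCode.recovers_of_diagonal`).

Bursts: for `i < δ`, check row `i` meets the burst only at its entry `α`. For `i ≥ δ` the possible
support is a window of `b` consecutive columns that avoids the columns with `α`, so it suffices that
these `b` columns are independent over `K`.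

At most `a` erasures: for `i ≥ δ`, the unit column `τ + δ` takes the place of column `0`, and the
MDS code of `[I C]` corrects the erasures. For `i < δ`, the rows of `[I C]` other than the first
leave only the case of `a` erasures inside columns `1, …, τ`. There a `K`-linear functional on `L`
that kills `c i` but not `α * c i` removes one more position, every other erased symbol has image
zero, and check row `i` gives a contradiction. This is where `α ∉ K` is needed; for `δ = 1` only `i
= 0` occurs and `α ≠ 0` is enough.

It remains to choose `v` so that the windows are independent. In `unitEntry` the first `δ` columns
become unit vectors; this changes no window needed for decoding, but lets an induction over columns
start. The preceding window forces the functionals annihilating the `b - 1` columns before column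
`e` to form a space of dimension at most one. Independence of the window ending at `e` is then the
nonvanishing of one affine function of the free entries of column `e`. A few extra affine conditions
keep these functions nonzero at later columns. At most three conditions per column arise, fewer than
the field has elements. -/

theorem IsCauchyLike.transpose {C : Matrix (Fin p) (Fin r) F} (hC : IsCauchyLike C) :
    IsCauchyLike C.transpose := by
  intro m f g hf hg
  rw [← Matrix.det_transpose]
  exact hC m g f hg hf

theorem IsCauchyLike.map {L : Type*} [Field L] [Algebra F L] {C : Matrix (Fin p) (Fin r) F}
    (hC : IsCauchyLike C) : IsCauchyLike (C.map (algebraMap F L)) := by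
  intro m f g hf hg
  have := hC m f g hf hg
  rw [Matrix.submatrix_map, ← RingHom.mapMatrix_apply, ← RingHom.map_det]
  simpa using this

/-- The columns `T` and as many rows of `Z` form a square submatrix, whose kernel is trivial. -/
theorem IsCauchyLike.eq_zero_of_sum_eq_zero {C : Matrix (Fin p) (Fin r) F} (hC : IsCauchyLike C)
    (Z : Finset (Fin p)) (T : Finset (Fin r)) (y : Fin r → F) (hT : ∀ j ∉ T, y j = 0)
    (hy : ∀ i ∈ Z, ∑ j, C i j * y j = 0) (hcard : T.card ≤ Z.card) : y = 0 := by
  obtain ⟨Z', hZ', hcard'⟩ := Finset.exists_subset_card_eq hcard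
  set f := Z'.orderEmbOfFin hcard'
  set g := T.orderEmbOfFin rfl
  have hdet := hC T.card f g f.injective g.injective
  have hz : (fun l => y (g l)) = 0 := by
    refine Matrix.eq_zero_of_mulVec_eq_zero hdet ?_
    ext i
    have h1 := hy (f i) (hZ' (Finset.orderEmbOfFin_mem _ _ _))
    have h2 : ∑ j, C (f i) j * y j = ∑ j ∈ T, C (f i) j * y j := by
      symm
      apply Finset.sum_subset (Finset.subset_univ _)
      intro j _ hj
      rw [hT j hj, mul_zero]
    have h3 : T = Finset.univ.map g.toEmbedding := by
      rw [← Finset.coe_inj]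
      simp [g]
    have h4 : ∑ j ∈ T, C (f i) j * y j = ∑ l, C (f i) (g l) * y (g l) := by
      have := Finset.sum_map Finset.univ g.toEmbedding (fun j => C (f i) j * y j)
      rwa [← h3] at this
    rw [h2, h4] at h1
    simpa [Matrix.mulVec, dotProduct] using h1
  ext j
  by_cases hj : j ∈ T
  · have : j ∈ Set.range g := by simpa [g] using hj
    obtain ⟨l, rfl⟩ := this
    exact congrFun hz l
  · exact hT j hj

/-- Clearing denominators turns a kernel vector `c` into a polynomial `∑ j, c j * ∏ l ≠ j, (X - y
l)` of degree below `m` with the `m` distinct roots `x i`. It vanishes, and its value at `y j` is a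
nonzero multiple of `c j`. -/
theorem isCauchyLike_cauchyMatrix (x : Fin p → F) (y : Fin r → F)
    (h : Function.Injective (Sum.elim x y)) : IsCauchyLike (cauchyMatrix x y) := by
  open Polynomial in
  intro m f g hf hg hdet
  obtain ⟨c, hc0, hc⟩ := Matrix.exists_mulVec_eq_zero_iff.mpr hdet
  have hxy : ∀ i j, x i - y j ≠ 0 := fun i j he => by
    have := @h (Sum.inl i) (Sum.inr j) (by simpa using sub_eq_zero.mp he)
    simp at this
  have hx : Function.Injective x := fun i j he => by
    simpa using @h (Sum.inl i) (Sum.inl j) (by simpa using he)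
  have hy : Function.Injective y := fun i j he => by
    simpa using @h (Sum.inr i) (Sum.inr j) (by simpa using he)
  let Q : Fin m → F[X] := fun j => ∏ l ∈ Finset.univ.erase j, (X - Polynomial.C (y (g l)))
  let P : F[X] := ∑ j, Polynomial.C (c j) * Q j
  have hdeg : P.degree < (m : ℕ) := by
    refine lt_of_le_of_lt (Polynomial.degree_sum_le _ _) ?_
    refine (Finset.sup_lt_iff (WithBot.bot_lt_coe m)).mpr fun j _ => ?_
    refine lt_of_le_of_lt (Polynomial.degree_mul_le _ _) ?_
    have h1 : (Q j).degree = ((m - 1 : ℕ) : WithBot ℕ) := by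
      simp only [Q, Polynomial.degree_prod, Polynomial.degree_X_sub_C]
      simp
    have h2 : (Polynomial.C (c j)).degree ≤ 0 := Polynomial.degree_C_le
    have hm : 0 < m := j.pos
    calc _ ≤ (0 : WithBot ℕ) + (Q j).degree := by gcongr
      _ < _ := by rw [h1, zero_add]; exact WithBot.coe_lt_coe.mpr (Nat.sub_lt hm one_pos)
  have hroot : ∀ i, P.eval (x (f i)) = 0 := by
    intro i
    have h1 : ∑ j, (x (f i) - y (g j))⁻¹ * c j = 0 := by
      simpa [Matrix.mulVec, dotProduct, cauchyMatrix] using congrFun hc i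
    have h2 : P.eval (x (f i)) =
        (∏ l, (x (f i) - y (g l))) * ∑ j, (x (f i) - y (g j))⁻¹ * c j := by
      simp only [P, Q, Polynomial.eval_finsetSum, Polynomial.eval_mul, Polynomial.eval_C,
        Polynomial.eval_prod, Polynomial.eval_sub, Polynomial.eval_X, Finset.mul_sum]
      refine Finset.sum_congr rfl fun j _ => ?_
      rw [← Finset.mul_prod_erase Finset.univ _ (Finset.mem_univ j)]
      field_simp [hxy (f i) (g j)]
    rw [h2, h1, mul_zero]
  have hP : P = 0 := by
    refine Polynomial.eq_zero_of_degree_lt_of_eval_index_eq_zero (v := fun i => x (f i))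
      (s := Finset.univ) ?_ (by simpa using hdeg) (fun i _ => hroot i)
    exact (hx.comp hf).injOn
  apply hc0
  ext j
  have h1 : P.eval (y (g j)) = c j * (Q j).eval (y (g j)) := by
    simp only [P, Polynomial.eval_finsetSum, Polynomial.eval_mul, Polynomial.eval_C]
    refine Finset.sum_eq_single j (fun l _ hl => ?_) (by simp)
    have : (Q l).eval (y (g j)) = 0 := by
      simp only [Q, Polynomial.eval_prod]
      exact Finset.prod_eq_zero (i := j) (by simp [hl.symm]) (by simp)
    rw [this, mul_zero]
  have h2 : (Q j).eval (y (g j)) ≠ 0 := by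
    simp only [Q, Polynomial.eval_prod]
    refine Finset.prod_ne_zero_iff.mpr fun l hl => ?_
    have hlj : l ≠ j := (Finset.mem_erase.mp hl).1
    simpa [sub_eq_zero] using fun he => hlj (hg (hy he)).symm
  rw [hP, Polynomial.eval_zero] at h1
  simpa using (mul_eq_zero.mp h1.symm).resolve_right h2

/-- The entries of `[I C]`, extended by zero. -/
def blockEntry (C : Matrix (Fin p) (Fin r) F) (i j : ℕ) : F :=
  if i = j then 1
  else if h : i < p ∧ p ≤ j ∧ j < p + r then C ⟨i, h.1⟩ ⟨j - p, by omega⟩ else 0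

theorem blockEntry_self (C : Matrix (Fin p) (Fin r) F) (i : ℕ) : blockEntry C i i = 1 := by
  simp [blockEntry]

theorem blockEntry_of_lt (C : Matrix (Fin p) (Fin r) F) {i j : ℕ} (hj : j < p) :
    blockEntry C i j = if i = j then 1 else 0 := by
  unfold blockEntry
  split_ifs <;> first | rfl | omega

theorem blockEntry_add (C : Matrix (Fin p) (Fin r) F) (i : Fin p) (j : Fin r) :
    blockEntry C i (p + j) = C i j := by
  unfold blockEntry
  rw [if_neg (by omega), dif_pos ⟨i.2, by omega, by omega⟩]
  congr 2
  simp

theorem sum_blockEntry_mul (C : Matrix (Fin p) (Fin r) F) (i : Fin p) (c : ℕ → F) :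
    ∑ j ∈ Finset.range (p + r), blockEntry C i j * c j = c i + ∑ j, C i j * c (p + j) := by
  rw [Finset.sum_range_add]
  congr 1
  · rw [Finset.sum_eq_single (i : ℕ), blockEntry_self, one_mul]
    · intro j hj hne
      rw [blockEntry_of_lt C (Finset.mem_range.mp hj), if_neg (Ne.symm hne), zero_mul]
    · intro h
      exact absurd (Finset.mem_range.mpr i.2) h
  · rw [Finset.sum_range]
    simp only [blockEntry_add]

/-- A vector on the columns of `[I C]` of small weight which satisfies the checks in the rows `R`
vanishes, apart from the unit columns that belong to the other rows. -/
theorem IsCauchyLike.right_kernel {C : Matrix (Fin p) (Fin r) F} (hC : IsCauchyLike C)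
    (R S : Finset ℕ) (hR : ∀ i ∈ R, i < p) (c : ℕ → F)
    (hc : ∀ i ∈ R, ∑ j ∈ Finset.range (p + r), blockEntry C i j * c j = 0)
    (hS : ∀ j < p + r, (j < p → j ∈ R) → c j ≠ 0 → j ∈ S) (hcard : S.card ≤ R.card) :
    ∀ j < p + r, (j < p → j ∈ R) → c j = 0 := by
  classical
  have hy : (fun j : Fin r => c (p + j)) = 0 := by
    -- In a row of `R` outside `S` the unit coordinate is zero, so the check involves `C` alone.
    -- There are `|R \ S|` such rows, and at most `|S \ R| ≤ |R \ S|` nonzero coordinates in the `C`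
    -- part.
    refine hC.eq_zero_of_sum_eq_zero {i : Fin p | (i : ℕ) ∈ R ∧ (i : ℕ) ∉ S}
      {j : Fin r | p + (j : ℕ) ∈ S} _ ?_ ?_ ?_
    · intro j hj
      by_contra hne
      exact hj (by simpa using hS _ (by omega) (by omega) hne)
    · intro i hi
      simp only [Finset.mem_filter, Finset.mem_univ, true_and] at hi
      have h0 : c i = 0 := by
        by_contra hne
        exact hi.2 (hS _ (by omega) (fun _ => hi.1) hne)
      have := hc i hi.1
      rwa [sum_blockEntry_mul, h0, zero_add] at this
    · have h1 : (Finset.univ.filter fun j : Fin r => p + (j : ℕ) ∈ S).card ≤ (S \ R).card := by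
        refine Finset.card_le_card_of_injOn (fun j : Fin r => p + (j : ℕ)) ?_ ?_
        · intro j hj
          simp only [Finset.coe_filter, Finset.mem_univ, true_and, Set.mem_ofPred_eq] at hj
          simp only [Finset.coe_sdiff, Set.mem_sdiff, Finset.mem_coe]
          exact ⟨hj, fun h => by have := hR _ h; omega⟩
        · intro i _ j _ hij
          ext
          simpa using hij
      have h2 : (R \ S).card ≤
          (Finset.univ.filter fun i : Fin p => (i : ℕ) ∈ R ∧ (i : ℕ) ∉ S).card := by
        have : R \ S ⊆ (Finset.univ.filter fun i : Fin p => (i : ℕ) ∈ R ∧ (i : ℕ) ∉ S).image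
            (fun i : Fin p => (i : ℕ)) := by
          intro i hi
          rw [Finset.mem_sdiff] at hi
          simp only [Finset.mem_image, Finset.mem_filter, Finset.mem_univ, true_and]
          exact ⟨⟨i, hR i hi.1⟩, hi, rfl⟩
        exact (Finset.card_le_card this).trans Finset.card_image_le
      have h3 : (S \ R).card ≤ (R \ S).card := by
        have e1 := Finset.card_sdiff_add_card_inter S R
        have e2 := Finset.card_sdiff_add_card_inter R S
        rw [Finset.inter_comm] at e2
        omega
      omega
  intro j hj hjR
  by_cases hjp : j < p
  · have := hc j (hjR hjp)
    rw [sum_blockEntry_mul C ⟨j, hjp⟩] at this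
    have h0 : ∀ l : Fin r, c (p + l) = 0 := fun l => congrFun hy l
    simpa [h0] using this
  · have := congrFun hy ⟨j - p, by omega⟩
    simpa [show p + (j - p) = j by omega] using this

/-- Any `p` columns of `[I C]` have trivial left kernel. -/
theorem IsCauchyLike.left_kernel {C : Matrix (Fin p) (Fin r) F} (hC : IsCauchyLike C)
    (J : Finset ℕ) (hJ : ∀ j ∈ J, j < p + r) (hcard : p ≤ J.card) (φ : ℕ → F)
    (hφ : ∀ j ∈ J, ∑ i ∈ Finset.range p, φ i * blockEntry C i j = 0) : ∀ i < p, φ i = 0 := by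
  classical
  have hsmall : ∀ i < p, i ∈ J → φ i = 0 := by
    intro i hi hiJ
    have := hφ i hiJ
    rw [Finset.sum_eq_single i] at this
    · simpa [blockEntry_self] using this
    · intro l _ hl
      rw [blockEntry_of_lt C hi, if_neg hl, mul_zero]
    · intro h
      exact absurd (Finset.mem_range.mpr hi) h
  have h0 : (fun i : Fin p => φ i) = 0 := by
    -- Unit columns in `J` kill their own coordinate of `φ`. The surviving coordinates are no more
    -- numerous than the columns of `C` in `J`, since `p ≤ |J|`.
    refine hC.transpose.eq_zero_of_sum_eq_zero {j : Fin r | p + (j : ℕ) ∈ J}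
      {i : Fin p | (i : ℕ) ∉ J} _ ?_ ?_ ?_
    · intro i hi
      exact hsmall i i.2 (by simpa using hi)
    · intro j hj
      have := hφ (p + j) (by simpa using hj)
      rw [Finset.sum_range] at this
      simp only [blockEntry_add] at this
      rw [← this]
      exact Finset.sum_congr rfl fun i _ => by rw [Matrix.transpose_apply, mul_comm]
    · have h1 : J.card ≤ (Finset.univ.filter fun i : Fin p => (i : ℕ) ∈ J).card +
          (Finset.univ.filter fun j : Fin r => p + (j : ℕ) ∈ J).card := by
        have : J ⊆ (Finset.univ.filter fun i : Fin p => (i : ℕ) ∈ J).image (fun i : Fin p => (i : ℕ)) ∪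
            (Finset.univ.filter fun j : Fin r => p + (j : ℕ) ∈ J).image
              (fun j : Fin r => p + (j : ℕ)) := by
          intro j hj
          have hlt := hJ j hj
          simp only [Finset.mem_union, Finset.mem_image, Finset.mem_filter, Finset.mem_univ,
            true_and]
          by_cases hjp : j < p
          · exact Or.inl ⟨⟨j, hjp⟩, hj, rfl⟩
          · refine Or.inr ⟨⟨j - p, by omega⟩, ?_, ?_⟩ <;> simp [show p + (j - p) = j by omega, hj]
        exact (Finset.card_le_card this).trans ((Finset.card_union_le _ _).trans
          (add_le_add Finset.card_image_le Finset.card_image_le))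
      have h2 := Finset.card_filter_add_card_filter_not (s := (Finset.univ : Finset (Fin p)))
        (fun i : Fin p => (i : ℕ) ∈ J)
      simp only [Finset.card_univ, Fintype.card_fin] at h2
      omega
  intro i hi
  exact congrFun h0 ⟨i, hi⟩

end CauchyLike

/-! ### Avoiding the zeros of affine functions -/

section AffineAvoidance
variable {K : Type*} [Field K]

/-- `f` is affine along every line. -/
def IsAffineFun (f : (ℕ → K) → K) : Prop :=
  ∀ (x y : ℕ → K) (t : K), f (fun i => (1 - t) * x i + t * y i) = (1 - t) * f x + t * f y

/-- Fewer than `|K|` affine functions, none of them identically zero, have a common non-root. -/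
theorem exists_forall_affine_ne_zero [Finite K] (s : List ((ℕ → K) → K))
    (hs : ∀ f ∈ s, IsAffineFun f ∧ ∃ x, f x ≠ 0) (hcard : s.length < Nat.card K) :
    ∃ x, ∀ f ∈ s, f x ≠ 0 := by
  classical
  induction s with
  | nil => exact ⟨0, by simp⟩
  | cons f s ih =>
    obtain ⟨x, hx⟩ := ih (fun g hg => hs g (List.mem_cons_of_mem _ hg))
      (by rw [List.length_cons] at hcard; omega)
    obtain ⟨hf, y, hy⟩ := hs f List.mem_cons_self
    by_cases hfx : f x = 0
    -- On the line from `x` to `y`, `f` vanishes only at `t = 0`, and every `g` in `s`, being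
    -- nonzero at `t = 0`, vanishes for at most one `t`. The set `bad` contains all these
    -- parameters.
    · let bad : Finset K := insert 0 (s.map fun g => -g x / (g y - g x)).toFinset
      have hbad : bad.card < Nat.card K := by
        refine lt_of_le_of_lt (Finset.card_insert_le _ _) ?_
        have := List.toFinset_card_le (s.map fun g => -g x / (g y - g x))
        rw [List.length_map] at this
        rw [List.length_cons] at hcard
        omega
      have : ∃ t, t ∉ bad := by
        by_contra! h
        have := Fintype.ofFinite K
        have hb : bad = Finset.univ := Finset.eq_univ_of_forall h
        rw [hb, Finset.card_univ, Nat.card_eq_fintype_card] at hbad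
        exact lt_irrefl _ hbad
      obtain ⟨t, ht⟩ := this
      have ht0 : t ≠ 0 := fun h => ht (by simp [bad, h])
      refine ⟨fun i => (1 - t) * x i + t * y i, fun g hg => ?_⟩
      rcases List.mem_cons.mp hg with rfl | hgs
      · rw [hf, hfx, mul_zero, zero_add]
        exact mul_ne_zero ht0 hy
      · intro h0
        rw [(hs g hg).1] at h0
        have h1 : t * (g y - g x) = -g x := by linear_combination h0
        have h2 : g y - g x ≠ 0 := by
          intro h
          rw [h, mul_zero] at h1
          exact hx g hgs (neg_eq_zero.mp h1.symm)
        apply ht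
        simp only [bad, Finset.mem_insert, List.mem_toFinset, List.mem_map]
        exact Or.inr ⟨g, hgs, by rw [← h1]; field_simp⟩
    · refine ⟨x, fun g hg => ?_⟩
      rcases List.mem_cons.mp hg with rfl | hgs
      · exact hfx
      · exact hx g hgs

/-- `φ` is supported on the rows `R` and annihilates the columns `J` of the matrix `H` with
rows `0, …, b - 1`. -/
def Annihilates (b : ℕ) (H : ℕ → ℕ → K) (R J : Finset ℕ) (φ : ℕ → K) : Prop :=
  (∀ i ∉ R, φ i = 0) ∧ ∀ j ∈ J, ∑ i ∈ Finset.range b, φ i * H i j = 0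

theorem Annihilates.sub_smul {b : ℕ} {H : ℕ → ℕ → K} {R J : Finset ℕ} {φ ψ : ℕ → K}
    (hφ : Annihilates b H R J φ) (hψ : Annihilates b H R J ψ) (c : K) :
    Annihilates b H R J (φ - c • ψ) := by
  refine ⟨fun i hi => by simp [hφ.1 i hi, hψ.1 i hi], fun j hj => ?_⟩
  have h1 := hφ.2 j hj
  have h2 := hψ.2 j hj
  simp only [Pi.sub_apply, Pi.smul_apply, smul_eq_mul, sub_mul, Finset.sum_sub_distrib, h1,
    mul_assoc, ← Finset.mul_sum, h2, mul_zero, sub_zero]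

theorem Annihilates.congr {b : ℕ} {H H' : ℕ → ℕ → K} {R J : Finset ℕ} {φ : ℕ → K}
    (hφ : Annihilates b H R J φ) (h : ∀ i, ∀ j ∈ J, H i j = H' i j) :
    Annihilates b H' R J φ :=
  ⟨hφ.1, fun j hj => by rw [← hφ.2 j hj]; simp only [h _ j hj]⟩

theorem Annihilates.mono {b : ℕ} {H : ℕ → ℕ → K} {R R' J J' : Finset ℕ} {φ : ℕ → K}
    (hφ : Annihilates b H R J φ) (hR : ∀ i ∉ R', φ i = 0) (hJ : J' ⊆ J) :
    Annihilates b H R' J' φ :=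
  ⟨hR, fun j hj => hφ.2 j (hJ hj)⟩

/-- If the annihilator of the columns `J` is at most one-dimensional and does not vanish on the
free positions of a new column, then the annihilator becomes trivial with the new column as soon
as an affine function of the free entries, not identically zero, is nonzero. -/
theorem exists_affine_of_annihilator {b : ℕ} {H : ℕ → ℕ → K} {R J free : Finset ℕ}
    (hfb : free ⊆ Finset.range b) (g : ℕ → K) (l : (ℕ → K) →ₗ[K] K)
    (hl : ∀ φ, Annihilates b H R J φ → l φ = 0 → φ = 0)
    (hfree : ∀ φ, Annihilates b H R J φ → (∀ i ∈ free, φ i = 0) → φ = 0) :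
    ∃ f : (ℕ → K) → K, (IsAffineFun f ∧ ∃ x, f x ≠ 0) ∧ ∀ x, f x ≠ 0 →
      ∀ φ, Annihilates b H R J φ →
        ∑ i ∈ Finset.range b, φ i * (if i ∈ free then x i else g i) = 0 → φ = 0 := by
  classical
  by_cases htriv : ∀ φ, Annihilates b H R J φ → φ = 0
  · exact ⟨fun _ => 1, ⟨fun x y t => by ring, 0, one_ne_zero⟩, fun x _ φ hφ _ => htriv φ hφ⟩
  push Not at htriv
  obtain ⟨ψ, hψ, hψ0⟩ := htriv
  have hlψ : l ψ ≠ 0 := fun h => hψ0 (hl ψ hψ h)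
  let f : (ℕ → K) → K := fun x =>
    ∑ i ∈ Finset.range b, ψ i * (if i ∈ free then x i else g i)
  refine ⟨f, ⟨?_, ?_⟩, ?_⟩
  · intro x y t
    simp only [f, Finset.mul_sum, ← Finset.sum_add_distrib]
    refine Finset.sum_congr rfl fun i _ => ?_
    split_ifs <;> ring
  · by_contra! h
    apply hψ0
    refine hfree ψ hψ fun i hi => ?_
    have h1 := h (Pi.single i 1)
    have h0 := h 0
    -- The coefficient of a free entry in the affine function is the matching coordinate of `ψ`, so
    -- `f` can vanish identically only if `ψ` vanishes on the free rows.
    have h2 : f (Pi.single i 1) - f 0 = ψ i := by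
      simp only [f, ← Finset.sum_sub_distrib]
      rw [Finset.sum_eq_single i]
      · simp [hi]
      · intro j _ hj
        simp [hj]
      · intro hn
        exact absurd (hfb hi) hn
    rw [← h2, h1, h0, sub_zero]
  · intro x hx φ hφ hsum
    have hφψ : φ = (l φ / l ψ) • ψ := by
      refine sub_eq_zero.mp (hl _ (hφ.sub_smul hψ _) ?_)
      simp [hlψ]
    have h1 : (l φ / l ψ) * f x = 0 := by
      rw [← hsum]
      simp only [f, Finset.mul_sum]
      refine Finset.sum_congr rfl fun i _ => ?_
      conv_rhs => rw [hφψ]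
      simp only [Pi.smul_apply, smul_eq_mul]
      ring
    rw [hφψ, (mul_eq_zero.mp h1).resolve_right hx, zero_smul]

/-- Columns can be chosen one after the other. -/
theorem exists_of_forall_column {P : ℕ → (ℕ → ℕ → K) → Prop}
    (hlocal : ∀ e v w, (∀ i, ∀ j ≤ e, v i j = w i j) → P e v → P e w)
    (hstep : ∀ e v, (∀ e' < e, P e' v) →
      ∃ x : ℕ → K, P e (fun i j => if j = e then x i else v i j)) (N : ℕ) :
    ∃ v, ∀ e < N, P e v := by
  induction N with
  | zero => exact ⟨0, by simp⟩
  | succ N ih =>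
    obtain ⟨v, hv⟩ := ih
    obtain ⟨x, hx⟩ := hstep N v hv
    refine ⟨fun i j => if j = N then x i else v i j, fun e he => ?_⟩
    rcases Nat.lt_succ_iff_lt_or_eq.mp he with h | rfl
    · refine hlocal e v _ (fun i j hj => ?_) (hv e h)
      rw [if_neg (by omega)]
    · exact hx

end AffineAvoidance

/-! ### Column-by-column choice of the free entries -/

section Greedy
variable {K : Type*} [Field K] {a b τ : ℕ}

/-- The construction with its first `b - a` columns replaced by unit vectors. -/
def unitEntry (b : ℕ) (C : Matrix (Fin a) (Fin (τ + 1 - a)) K) (v : ℕ → ℕ → K) (i j : ℕ) : K :=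
  if i < b - a then
    if j = i then 1 else if b + i ≤ j ∧ j ≤ τ + i then v i j else 0
  else if j < b - a then 0
  else if j < τ + 1 then blockEntry C (i - (b - a)) j
  else if 0 < b - a ∧ i = b - a ∧ j = τ + (b - a) then 1 else 0

/-- The rows of column `e` which carry a free entry. -/
def freeRows (a b τ e : ℕ) : Finset ℕ := {i ∈ Finset.range (b - a) | b + i ≤ e ∧ e ≤ τ + i}

theorem mem_freeRows {e i : ℕ} : i ∈ freeRows a b τ e ↔ i < b - a ∧ b + i ≤ e ∧ e ≤ τ + i := by
  simp [freeRows]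

variable (C : Matrix (Fin a) (Fin (τ + 1 - a)) K) (v : ℕ → ℕ → K)

theorem unitEntry_congr {w : ℕ → ℕ → K} {i j : ℕ} (h : v i j = w i j) :
    unitEntry b C v i j = unitEntry b C w i j := by
  simp [unitEntry, h]

theorem unitEntry_update {e : ℕ} (he : b ≤ e) (x : ℕ → K) (i : ℕ) :
    unitEntry b C (fun i j => if j = e then x i else v i j) i e =
      if i ∈ freeRows a b τ e then x i else unitEntry b C v i e := by
  simp only [mem_freeRows, unitEntry]
  split_ifs <;> first | rfl | omega

theorem sum_unitEntry_unit (φ : ℕ → K) {r : ℕ} (hr : r < b - a) :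
    ∑ i ∈ Finset.range b, φ i * unitEntry b C v i r = φ r := by
  rw [Finset.sum_eq_single r]
  · simp [unitEntry, hr]
  · intro i _ hi
    have : unitEntry b C v i r = 0 := by
      unfold unitEntry
      split_ifs <;> first | rfl | omega
    rw [this, mul_zero]
  · intro h
    exact absurd (Finset.mem_range.mpr (by omega)) h

theorem sum_unitEntry_bottom (hab : a ≤ b) (φ : ℕ → K) {j : ℕ} (hj : b - a ≤ j) (hjt : j ≤ τ)
    (hφ : ∀ i < b - a, φ i = 0) :
    ∑ i ∈ Finset.range b, φ i * unitEntry b C v i j =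
      ∑ i ∈ Finset.range a, φ (b - a + i) * blockEntry C i j := by
  have hb : Finset.range b = Finset.range (b - a + a) := by rw [Nat.sub_add_cancel hab]
  rw [hb, Finset.sum_range_add, Finset.sum_eq_zero, zero_add]
  · refine Finset.sum_congr rfl fun i _ => ?_
    congr 1
    unfold unitEntry
    rw [if_neg (by omega), if_neg (by omega), if_pos (by omega)]
    congr 1
    omega
  · intro i hi
    rw [hφ i (Finset.mem_range.mp hi), zero_mul]

variable {C v}

/-- Once the upper rows drop out, any `a` columns between `δ` and `τ` are columns of the MDS matrix
`[I C]`. -/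
theorem eq_zero_of_bottom (hC : IsCauchyLike C) (hab : a ≤ b) (hbt : b ≤ τ) {φ : ℕ → K}
    (h0 : ∀ i < b - a, φ i = 0) (hbig : ∀ i, b ≤ i → φ i = 0) (J : Finset ℕ)
    (hJ : ∀ j ∈ J, b - a ≤ j ∧ j ≤ τ) (hcard : a ≤ J.card)
    (hφ : ∀ j ∈ J, ∑ i ∈ Finset.range b, φ i * unitEntry b C v i j = 0) : φ = 0 := by
  have := hC.left_kernel J (fun j hj => by have := (hJ j hj).2; omega) hcard
    (fun i => φ (b - a + i)) (fun j hj => by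
      rw [← sum_unitEntry_bottom C v hab φ (hJ j hj).1 (hJ j hj).2 h0]
      exact hφ j hj)
  ext i
  by_cases h1 : i < b - a
  · exact h0 i h1
  by_cases h2 : b ≤ i
  · exact hbig i h2
  have := this (i - (b - a)) (by omega)
  rwa [show b - a + (i - (b - a)) = i by omega] at this

/-- Vanishing in row `δ` amounts to annihilating the unit column `0` of `[I C]`, which supplies the
missing `a`-th column. -/
theorem eq_zero_of_bottom_of_unit (hC : IsCauchyLike C) (ha : 1 ≤ a) (hab : a < b) (hbt : b ≤ τ)
    {φ : ℕ → K} (h0 : ∀ i ≤ b - a, φ i = 0) (hbig : ∀ i, b ≤ i → φ i = 0) (J : Finset ℕ)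
    (hJ : ∀ j ∈ J, b - a ≤ j ∧ j ≤ τ) (hcard : a ≤ J.card + 1)
    (hφ : ∀ j ∈ J, ∑ i ∈ Finset.range b, φ i * unitEntry b C v i j = 0) : φ = 0 := by
  have h0J : 0 ∉ J := fun h => by have := (hJ 0 h).1; omega
  have := hC.left_kernel (insert 0 J) (fun j hj => by
      rcases Finset.mem_insert.mp hj with rfl | hj
      · omega
      · have := (hJ j hj).2; omega) (by rwa [Finset.card_insert_of_notMem h0J])
    (fun i => φ (b - a + i)) (fun j hj => by
      rcases Finset.mem_insert.mp hj with rfl | hj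
      · refine Finset.sum_eq_zero fun i _ => ?_
        rw [blockEntry_of_lt C (by omega)]
        split_ifs with h
        · rw [h, h0 _ (by omega), zero_mul]
        · rw [mul_zero]
      · rw [← sum_unitEntry_bottom C v hab.le φ (hJ j hj).1 (hJ j hj).2
          (fun i hi => h0 i hi.le)]
        exact hφ j hj)
  ext i
  by_cases h1 : i < b - a
  · exact h0 i h1.le
  by_cases h2 : b ≤ i
  · exact hbig i h2
  have := this (i - (b - a)) (by omega)
  rwa [show b - a + (i - (b - a)) = i by omega] at this

/-- The upper rows, the first one excepted, of a functional which annihilates the `b - 1` columns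
before column `e` and the free rows of column `e`. -/
theorem upper_eq_zero {e : ℕ} (hbt : b ≤ τ) (het : e ≤ τ + (b - a)) {R : Finset ℕ}
    {φ : ℕ → K} (hφ : Annihilates b (unitEntry b C v) R (Finset.Ico (e + 1 - b) e) φ)
    (hv : ∀ r, 1 ≤ r → r < b - a → τ + r < e → v r (τ + r) ≠ 0)
    (hfree : ∀ i ∈ freeRows a b τ e, φ i = 0) (hbe : b ≤ e) :
    ∀ r, 1 ≤ r → r < b - a → φ r = 0 := by
  suffices h : ∀ m r, b - a - r = m → 1 ≤ r → r < b - a → φ r = 0 from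
    fun r => h _ r rfl
  intro m
  induction m using Nat.strong_induction_on with
  | _ m ih =>
    intro r hm h1 hr
    -- Three reasons for `φ r = 0`: the unit column `r` still lies in the window; row `r` is free in
    -- column `e`; or column `τ + r`, whose nonzero entries lie in rows `r, …, δ - 1`, lies in the
    -- window. The last case uses the corner entry and downward induction on `r`.
    by_cases hre : e < b + r
    · rw [← sum_unitEntry_unit C v φ hr]
      exact hφ.2 r (by simp; omega)
    by_cases hfr : e ≤ τ + r
    · exact hfree r (mem_freeRows.mpr ⟨hr, by omega, hfr⟩)
    have hcol := hφ.2 (τ + r) (by simp; omega)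
    rw [Finset.sum_eq_single r] at hcol
    · have : unitEntry b C v r (τ + r) = v r (τ + r) := by
        unfold unitEntry
        rw [if_pos hr, if_neg (by omega), if_pos (by omega)]
      rw [this] at hcol
      exact (mul_eq_zero.mp hcol).resolve_right (hv r h1 hr (by omega))
    · intro i _ hir
      by_cases hi : r < i ∧ i < b - a
      · rw [ih (b - a - i) (by omega) i rfl (by omega) hi.2, zero_mul]
      · have : unitEntry b C v i (τ + r) = 0 := by
          unfold unitEntry
          split_ifs <;> first | rfl | omega
        rw [this, mul_zero]
    · intro h
      exact absurd (Finset.mem_range.mpr (by omega)) h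

/-- The `b` columns up to column `e` are independent. -/
def WindowIndep (b : ℕ) (H : ℕ → ℕ → K) (e : ℕ) : Prop :=
  ∀ φ, Annihilates b H (Finset.range b) (Finset.Ico (e + 1 - b) (e + 1)) φ → φ = 0

/-- The first `b` columns are `δ` unit vectors followed by `a` columns of `[I C]`, so no condition
on `v` is needed. -/
theorem windowIndep_first (hC : IsCauchyLike C) (ha : 1 ≤ a) (hab : a ≤ b) (hbt : b ≤ τ) :
    WindowIndep b (unitEntry b C v) (b - 1) := by
  intro φ hφ
  have h0 : ∀ i < b - a, φ i = 0 := fun i hi => by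
    rw [← sum_unitEntry_unit C v φ hi]
    exact hφ.2 i (by simp; omega)
  refine eq_zero_of_bottom hC hab hbt h0 (fun i hi => hφ.1 i (by simpa using hi))
    (Finset.Ico (b - a) b) (fun j hj => ?_) (by simp; omega) (fun j hj => hφ.2 j ?_)
  · rw [Finset.mem_Ico] at hj; omega
  · rw [Finset.mem_Ico] at hj ⊢; omega

/-- The requirements on column `e`. -/
structure ColumnGood (a b τ : ℕ) (C : Matrix (Fin a) (Fin (τ + 1 - a)) K) (e : ℕ)
    (v : ℕ → ℕ → K) : Prop where
  window : WindowIndep b (unitEntry b C v) e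
  -- Beyond column `τ`, row `0` has no free entry. This condition handles row `0` together with the
  -- rows of `[I C]` there; for `δ < 2` no such column precedes `τ + δ`.
  last : e = τ → 2 ≤ b - a → ∀ φ, Annihilates b (unitEntry b C v)
    (insert 0 (Finset.Ico (b - a) b)) (Finset.Ico (τ - a) (τ + 1)) φ → φ = 0
  -- Needed for the final window, whose last column is the unit vector of row `δ` and so removes
  -- that row.
  last_unit : e = τ → ∀ φ, Annihilates b (unitEntry b C v)
    (insert 0 (Finset.Ico (b - a + 1) b)) (Finset.Ico (τ + 1 - a) (τ + 1)) φ → φ = 0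
  -- The last free entry of row `r` serves as a pivot in later windows.
  corner : ∀ r, 1 ≤ r → r < b - a → e = τ + r → v r e ≠ 0

theorem ColumnGood.congr {e : ℕ} {w : ℕ → ℕ → K} (h : ∀ i, ∀ j ≤ e, v i j = w i j)
    (hv : ColumnGood a b τ C e v) : ColumnGood a b τ C e w where
  window φ hφ := hv.window φ (hφ.congr fun i j hj =>
    (unitEntry_congr C v (h i j (by rw [Finset.mem_Ico] at hj; omega))).symm)
  last he h2 φ hφ := hv.last he h2 φ (hφ.congr fun i j hj =>
    (unitEntry_congr C v (h i j (by rw [Finset.mem_Ico] at hj; omega))).symm)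
  last_unit he φ hφ := hv.last_unit he φ (hφ.congr fun i j hj =>
    (unitEntry_congr C v (h i j (by rw [Finset.mem_Ico] at hj; omega))).symm)
  corner r h1 hr he := by
    rw [← h r e le_rfl]
    exact hv.corner r h1 hr he

/-- Annihilators of the updated matrix annihilate the old columns, and the new column. -/
theorem Annihilates.of_update {e m : ℕ} (hbe : b ≤ e) (hm : m ≤ e) {x : ℕ → K} {R : Finset ℕ}
    {φ : ℕ → K} (hφ : Annihilates b (unitEntry b C (fun i j => if j = e then x i else v i j)) R
      (Finset.Ico m (e + 1)) φ) :
    Annihilates b (unitEntry b C v) R (Finset.Ico m e) φ ∧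
      ∑ i ∈ Finset.range b,
        φ i * (if i ∈ freeRows a b τ e then x i else unitEntry b C v i e) = 0 := by
  constructor
  · refine (hφ.mono (J' := Finset.Ico m e) hφ.1 ?_).congr fun i j hj => ?_
    · exact Finset.Ico_subset_Ico le_rfl (by omega)
    · refine unitEntry_congr C _ (if_neg ?_)
      rw [Finset.mem_Ico] at hj; omega
  · rw [← hφ.2 e (by rw [Finset.mem_Ico]; omega)]
    simp only [unitEntry_update C v hbe]

/-- The column `e - b` that leaves the window separates the annihilators of the remaining `b - 1`
columns, because the preceding window is independent. -/
theorem exists_affine_window (hC : IsCauchyLike C) (ha : 1 ≤ a) (hab : a < b) (hbt : b ≤ τ)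
    {e : ℕ} (hbe : b ≤ e) (het : e < τ + (b - a))
    (hv : ∀ e' < e, b ≤ e' → ColumnGood a b τ C e' v) :
    ∃ f : (ℕ → K) → K, (IsAffineFun f ∧ ∃ x, f x ≠ 0) ∧ ∀ x, f x ≠ 0 →
      WindowIndep b (unitEntry b C (fun i j => if j = e then x i else v i j)) e := by
  let l : (ℕ → K) →ₗ[K] K :=
    { toFun := fun φ => ∑ i ∈ Finset.range b, φ i * unitEntry b C v i (e - b)
      map_add' := fun φ ψ => by simp [add_mul, Finset.sum_add_distrib]
      map_smul' := fun c φ => by simp [Finset.mul_sum, mul_assoc] }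
  have hprev : WindowIndep b (unitEntry b C v) (e - 1) := by
    rcases Nat.eq_or_lt_of_le hbe with rfl | h
    · exact windowIndep_first hC ha hab.le hbt
    · exact (hv (e - 1) (by omega) (by omega)).window
  obtain ⟨f, hf, hfx⟩ := exists_affine_of_annihilator (b := b) (H := unitEntry b C v)
    (R := Finset.range b) (J := Finset.Ico (e + 1 - b) e) (free := freeRows a b τ e)
    (fun i hi => by rw [mem_freeRows] at hi; rw [Finset.mem_range]; omega)
    (fun i => unitEntry b C v i e) l
    (fun φ hφ hl => by
      refine hprev φ ⟨hφ.1, fun j hj => ?_⟩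
      rw [Finset.mem_Ico] at hj
      by_cases hje : j = e - b
      · rw [hje]; exact hl
      · exact hφ.2 j (by rw [Finset.mem_Ico]; omega))
    (fun φ hφ hfree => by
      have hbig : ∀ i, b ≤ i → φ i = 0 := fun i hi => hφ.1 i (by simpa using hi)
      have hup := upper_eq_zero hbt het.le hφ (fun r h1 hr hlt =>
        (hv (τ + r) hlt (by omega)).corner r h1 hr rfl) hfree hbe
      -- Only row `0` and the rows of `[I C]` are left. Up to column `τ`, row `0` is free in column
      -- `e`; beyond it, the condition `last` at column `τ` applies, as the window contains columns
      -- `τ - a, …, τ`.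
      by_cases hτ : e ≤ τ
      · have h0 : ∀ i < b - a, φ i = 0 := fun i hi => by
          rcases Nat.eq_zero_or_pos i with rfl | h
          · exact hfree 0 (mem_freeRows.mpr ⟨hi, by omega, by omega⟩)
          · exact hup i h hi
        refine eq_zero_of_bottom hC hab.le hbt h0 hbig (Finset.Ico (max (b - a) (e + 1 - b)) e)
          (fun j hj => ?_) (by simp; omega) (fun j hj => hφ.2 j ?_)
        · rw [Finset.mem_Ico] at hj; omega
        · rw [Finset.mem_Ico] at hj ⊢; omega
      · refine (hv τ (by omega) hbt).last rfl (by omega) φ (hφ.mono (fun i hi => ?_) ?_)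
        · simp only [Finset.mem_insert, Finset.mem_Ico, not_or] at hi
          by_cases hib : b ≤ i
          · exact hbig i hib
          · exact hup i (by omega) (by omega)
        · intro j hj
          rw [Finset.mem_Ico] at hj ⊢; omega)
  refine ⟨f, hf, fun x hx φ hφ => ?_⟩
  obtain ⟨h1, h2⟩ := hφ.of_update hbe (by omega)
  exact hfx x hx φ h1 h2

/-- With `φ 0 = 0` the `a` columns before `τ` already determine the lower rows, so the coordinate
`0` separates annihilators; row `0` is free in column `τ`. -/
theorem exists_affine_last (hC : IsCauchyLike C) (hab : a < b) (hbt : b ≤ τ) :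
    ∃ f : (ℕ → K) → K, (IsAffineFun f ∧ ∃ x, f x ≠ 0) ∧ ∀ x, f x ≠ 0 →
      ∀ φ, Annihilates b (unitEntry b C (fun i j => if j = τ then x i else v i j))
        (insert 0 (Finset.Ico (b - a) b)) (Finset.Ico (τ - a) (τ + 1)) φ → φ = 0 := by
  have key : ∀ φ, Annihilates b (unitEntry b C v) (insert 0 (Finset.Ico (b - a) b))
      (Finset.Ico (τ - a) τ) φ → φ 0 = 0 → φ = 0 := by
    intro φ hφ h0
    refine eq_zero_of_bottom hC hab.le hbt (fun i hi => ?_) (fun i hi => ?_) _ (fun j hj => ?_)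
      ?_ hφ.2
    · rcases Nat.eq_zero_or_pos i with rfl | h
      · exact h0
      · exact hφ.1 i (by simp; omega)
    · exact hφ.1 i (by simp; omega)
    · rw [Finset.mem_Ico] at hj; omega
    · simp; omega
  obtain ⟨f, hf, hfx⟩ := exists_affine_of_annihilator (free := freeRows a b τ τ)
    (fun i hi => by rw [mem_freeRows] at hi; rw [Finset.mem_range]; omega)
    (fun i => unitEntry b C v i τ) (LinearMap.proj 0) key
    (fun φ hφ h => key φ hφ (h 0 (mem_freeRows.mpr ⟨by omega, by omega, by omega⟩)))
  refine ⟨f, hf, fun x hx φ hφ => ?_⟩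
  obtain ⟨h1, h2⟩ := hφ.of_update hbt (by omega)
  exact hfx x hx φ h1 h2

/-- As for `exists_affine_last`, but the absent row `δ` compensates for having one column fewer. -/
theorem exists_affine_last_unit (hC : IsCauchyLike C) (ha : 1 ≤ a) (hab : a < b) (hbt : b ≤ τ) :
    ∃ f : (ℕ → K) → K, (IsAffineFun f ∧ ∃ x, f x ≠ 0) ∧ ∀ x, f x ≠ 0 →
      ∀ φ, Annihilates b (unitEntry b C (fun i j => if j = τ then x i else v i j))
        (insert 0 (Finset.Ico (b - a + 1) b)) (Finset.Ico (τ + 1 - a) (τ + 1)) φ → φ = 0 := by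
  have key : ∀ φ, Annihilates b (unitEntry b C v) (insert 0 (Finset.Ico (b - a + 1) b))
      (Finset.Ico (τ + 1 - a) τ) φ → φ 0 = 0 → φ = 0 := by
    intro φ hφ h0
    refine eq_zero_of_bottom_of_unit hC ha hab hbt (fun i hi => ?_) (fun i hi => ?_) _
      (fun j hj => ?_) ?_ hφ.2
    · rcases Nat.eq_zero_or_pos i with rfl | h
      · exact h0
      · exact hφ.1 i (by simp; omega)
    · exact hφ.1 i (by simp; omega)
    · rw [Finset.mem_Ico] at hj; omega
    · simp; omega
  obtain ⟨f, hf, hfx⟩ := exists_affine_of_annihilator (free := freeRows a b τ τ)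
    (fun i hi => by rw [mem_freeRows] at hi; rw [Finset.mem_range]; omega)
    (fun i => unitEntry b C v i τ) (LinearMap.proj 0) key
    (fun φ hφ h => key φ hφ (h 0 (mem_freeRows.mpr ⟨by omega, by omega, by omega⟩)))
  refine ⟨f, hf, fun x hx φ hφ => ?_⟩
  obtain ⟨h1, h2⟩ := hφ.of_update hbt (by omega)
  exact hfx x hx φ h1 h2

theorem isAffineFun_apply (r : ℕ) : IsAffineFun (K := K) (fun x => x r) ∧ ∃ x : ℕ → K, x r ≠ 0 :=
  ⟨fun _ _ _ => rfl, 1, one_ne_zero⟩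

theorem exists_column [Finite K] (hC : IsCauchyLike C) (ha : 1 ≤ a) (hab : a < b) (hbt : b ≤ τ)
    (hK : τ + 1 ≤ Nat.card K) {e : ℕ} (hbe : b ≤ e) (het : e < τ + (b - a))
    (hv : ∀ e' < e, b ≤ e' → ColumnGood a b τ C e' v) :
    ∃ x : ℕ → K, ColumnGood a b τ C e (fun i j => if j = e then x i else v i j) := by
  obtain ⟨f, hf, hfx⟩ := exists_affine_window hC ha hab hbt hbe het hv
  by_cases heτ : e = τ
  · subst heτ
    obtain ⟨f₂, hf₂, hfx₂⟩ := exists_affine_last (v := v) hC hab hbt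
    obtain ⟨f₃, hf₃, hfx₃⟩ := exists_affine_last_unit (v := v) hC ha hab hbt
    -- The count is tight: three conditions require `τ ≥ 3`, which follows from `δ ≥ 2`. For `δ = 1`
    -- possibly `τ = 2`, and two conditions remain.
    by_cases h2 : 2 ≤ b - a
    · obtain ⟨x, hx⟩ := exists_forall_affine_ne_zero [f, f₂, f₃] (by simp [hf, hf₂, hf₃])
        (by simp only [List.length_cons, List.length_nil]; omega)
      exact ⟨x, hfx x (hx f (by simp)), fun _ _ => hfx₂ x (hx f₂ (by simp)),
        fun _ => hfx₃ x (hx f₃ (by simp)), fun r _ _ _ => by omega⟩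
    · obtain ⟨x, hx⟩ := exists_forall_affine_ne_zero [f, f₃] (by simp [hf, hf₃])
        (by simp only [List.length_cons, List.length_nil]; omega)
      exact ⟨x, hfx x (hx f (by simp)), fun _ h => absurd h h2,
        fun _ => hfx₃ x (hx f₃ (by simp)), fun r _ _ _ => by omega⟩
  -- For `e > τ` the second function is the corner entry in row `e - τ`; for `e < τ` truncated
  -- subtraction makes it a harmless condition on `x 0`.
  · obtain ⟨x, hx⟩ := exists_forall_affine_ne_zero [f, fun x => x (e - τ)]
      (by
        intro g hg
        simp only [List.mem_cons, List.not_mem_nil, or_false] at hg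
        rcases hg with rfl | rfl
        · exact hf
        · exact isAffineFun_apply _)
      (by simp only [List.length_cons, List.length_nil]; omega)
    refine ⟨x, hfx x (hx f (by simp)), fun h => absurd h heτ, fun h => absurd h heτ,
      fun r _ _ h => ?_⟩
    have := hx (fun x => x (e - τ)) (by simp)
    rw [if_pos rfl]
    rwa [show r = e - τ by omega]

/-- No entry of column `τ + δ` is free: it removes row `δ`, the corners remove rows `1, …, δ - 1`,
and `last_unit` treats the rest. -/
theorem windowIndep_last (ha : 1 ≤ a) (hab : a < b) (hbt : b ≤ τ)
    (hv : ∀ e < τ + (b - a), b ≤ e → ColumnGood a b τ C e v) :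
    WindowIndep b (unitEntry b C v) (τ + (b - a)) := by
  intro φ hφ
  have hbig : ∀ i, b ≤ i → φ i = 0 := fun i hi => hφ.1 i (by simpa using hi)
  have hφ' : Annihilates b (unitEntry b C v) (Finset.range b)
      (Finset.Ico (τ + (b - a) + 1 - b) (τ + (b - a))) φ :=
    hφ.mono hφ.1 (Finset.Ico_subset_Ico le_rfl (by omega))
  have hup := upper_eq_zero hbt le_rfl hφ' (fun r h1 hr hlt =>
    (hv (τ + r) hlt (by omega)).corner r h1 hr rfl)
    (fun i hi => by rw [mem_freeRows] at hi; omega) (by omega)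
  have hlast : φ (b - a) = 0 := by
    have := hφ.2 (τ + (b - a)) (by rw [Finset.mem_Ico]; omega)
    rw [Finset.sum_eq_single (b - a)] at this
    · have h1 : unitEntry b C v (b - a) (τ + (b - a)) = 1 := by
        unfold unitEntry
        split_ifs <;> first | rfl | omega
      rwa [h1, mul_one] at this
    · intro i _ hi
      have : unitEntry b C v i (τ + (b - a)) = 0 := by
        unfold unitEntry
        split_ifs <;> first | rfl | omega
      rw [this, mul_zero]
    · intro h
      exact absurd (Finset.mem_range.mpr (by omega)) h
  refine (hv τ (by omega) hbt).last_unit rfl φ (hφ.mono (fun i hi => ?_) ?_)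
  · simp only [Finset.mem_insert, Finset.mem_Ico, not_or] at hi
    by_cases hib : b ≤ i
    · exact hbig i hib
    · by_cases hi' : i = b - a
      · rw [hi']
        exact hlast
      · exact hup i (by omega) (by omega)
  · intro j hj
    rw [Finset.mem_Ico] at hj ⊢; omega

/-- The choice of `v` depends on `C` alone, so the same `v` serves every `α` and every extension
field. For `a = b` there is nothing to choose: all windows consist of columns of an MDS matrix. -/
theorem exists_windowIndep [Finite K] (hC : IsCauchyLike C) (ha : 1 ≤ a) (hab : a ≤ b)
    (hbt : b ≤ τ) (hK : τ + 1 ≤ Nat.card K) :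
    ∃ v : ℕ → ℕ → K, ∀ e, b ≤ e → e ≤ τ + (b - a) → WindowIndep b (unitEntry b C v) e := by
  rcases Nat.eq_or_lt_of_le hab with rfl | hlt
  · refine ⟨0, fun e hbe het φ hφ => ?_⟩
    refine eq_zero_of_bottom hC le_rfl hbt (fun i hi => by omega)
      (fun i hi => hφ.1 i (by simpa using hi)) _ (fun j hj => ?_) ?_ hφ.2
    · rw [Finset.mem_Ico] at hj; omega
    · simp; omega
  · obtain ⟨v, hv⟩ := exists_of_forall_column
      (P := fun e v => b ≤ e → e < τ + (b - a) → ColumnGood a b τ C e v)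
      (fun e v w h hP hb he => (hP hb he).congr h)
      (fun e v hv => by
        by_cases h : b ≤ e ∧ e < τ + (b - a)
        · obtain ⟨x, hx⟩ := exists_column hC ha hlt hbt hK h.1 h.2
            (fun e' he' hb => hv e' he' hb (by omega))
          exact ⟨x, fun _ _ => hx⟩
        · exact ⟨0, fun h1 h2 => absurd ⟨h1, h2⟩ h⟩) (τ + (b - a))
    refine ⟨v, fun e hbe het => ?_⟩
    rcases Nat.eq_or_lt_of_le het with rfl | he
    · exact windowIndep_last ha hlt hbt (fun e he hb => hv e he hb he)
    · exact (hv e he hbe he).window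

end Greedy

/-! ### Recovering one symbol of a codeword -/

section Codewords
variable {K L : Type*} [Field K] [Field L] [Algebra K L] {a b τ : ℕ}

/-- The entries of the parity-check matrix, with indices in `ℕ`. -/
def checkEntry (b : ℕ) (C : Matrix (Fin a) (Fin (τ + 1 - a)) K) (α : L) (v : ℕ → ℕ → K)
    (i j : ℕ) : L :=
  if i < b - a then
    if j = i then α else if b + i ≤ j ∧ j ≤ τ + i then algebraMap K L (v i j) else 0
  else if j < τ + 1 then algebraMap K L (blockEntry C (i - (b - a)) j)
  else if 0 < b - a ∧ i = b - a ∧ j = τ + (b - a) then 1 else 0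

theorem mdsBlock_eq_blockEntry (C : Matrix (Fin a) (Fin (τ + 1 - a)) K) (hat : a ≤ τ)
    (i : Fin a) (j : Fin (τ + 1)) : mdsBlock C i j = blockEntry C i j := by
  unfold mdsBlock
  rw [Matrix.of_apply]
  split_ifs with h
  · rw [blockEntry_of_lt C h, Matrix.one_apply]
    simp [Fin.ext_iff]
  · unfold blockEntry
    rw [if_neg (by omega), dif_pos ⟨i.2, by omega, by omega⟩]

variable {C : Matrix (Fin a) (Fin (τ + 1 - a)) K} {α : L} {v : ℕ → ℕ → K}

theorem constructionA_apply (hat : a ≤ τ) (i : Fin b) (j : Fin (τ + 1 + (b - a))) :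
    constructionA a b τ C α v i j = checkEntry b C α v i j := by
  unfold constructionA checkEntry
  simp only [Matrix.of_apply]
  split_ifs <;> first | rfl | (rw [mdsBlock_eq_blockEntry C hat])

/-- Extension of a finite vector by zero. -/
def extend {n : ℕ} (c : Fin n → L) (j : ℕ) : L := if h : j < n then c ⟨j, h⟩ else 0

theorem extend_val {n : ℕ} (c : Fin n → L) (j : Fin n) : extend c j = c j := by
  simp [extend]

theorem extend_of_le {n : ℕ} (c : Fin n → L) {j : ℕ} (h : n ≤ j) : extend c j = 0 := by
  simp [extend, h]

/-- `c` satisfies all parity checks. -/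
def SatisfiesChecks (b : ℕ) (C : Matrix (Fin a) (Fin (τ + 1 - a)) K) (α : L) (v : ℕ → ℕ → K)
    (c : ℕ → L) : Prop :=
  ∀ i < b, ∑ j ∈ Finset.range (τ + 1 + (b - a)), checkEntry b C α v i j * c j = 0

theorem satisfiesChecks_of_mem (hat : a ≤ τ) {c : Fin (τ + 1 + (b - a)) → L}
    (hc : c ∈ blockCode (constructionA a b τ C α v)) :
    SatisfiesChecks b C α v (extend c) := by
  intro i hi
  have h := congrFun (LinearMap.mem_ker.mp hc) ⟨i, hi⟩
  rw [Matrix.mulVecLin_apply] at h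
  simp only [Matrix.mulVec, dotProduct, constructionA_apply hat, Pi.zero_apply] at h
  rw [Finset.sum_range]
  simpa only [extend_val] using h

theorem SatisfiesChecks.upper_row {c : ℕ → L} (hc : SatisfiesChecks b C α v c) {i : ℕ}
    (hi : i < b - a) :
    α * c i + ∑ j ∈ Finset.Ico (b + i) (τ + i + 1), algebraMap K L (v i j) * c j = 0 := by
  rw [← hc i (by omega)]
  have h1 : Finset.Ico (b + i) (τ + i + 1) ⊆
      (Finset.range (τ + 1 + (b - a))).erase i := fun j hj => by
    rw [Finset.mem_Ico] at hj
    rw [Finset.mem_erase, Finset.mem_range]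
    omega
  have hmem : i ∈ Finset.range (τ + 1 + (b - a)) := Finset.mem_range.mpr (by omega)
  rw [← Finset.add_sum_erase _ _ hmem]
  congr 1
  · simp [checkEntry, hi]
  · rw [← Finset.sum_subset h1]
    · refine Finset.sum_congr rfl fun j hj => ?_
      rw [Finset.mem_Ico] at hj
      unfold checkEntry
      rw [if_pos hi, if_neg (by omega), if_pos (by omega)]
    · intro j hj hj'
      rw [Finset.mem_erase] at hj
      rw [Finset.mem_Ico] at hj'
      unfold checkEntry
      rw [if_pos hi, if_neg hj.1, if_neg (by omega), zero_mul]

theorem SatisfiesChecks.lower_row {c : ℕ → L} (hc : SatisfiesChecks b C α v c) (hab : a ≤ b)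
    {r : ℕ} (hr : r < a) :
    ∑ j ∈ Finset.range (τ + 1), algebraMap K L (blockEntry C r j) * c j +
      (if 0 < b - a ∧ r = 0 then c (τ + (b - a)) else 0) = 0 := by
  refine Eq.trans ?_ (hc (b - a + r) (by omega))
  rw [Finset.sum_range_add _ (τ + 1) (b - a)]
  refine congrArg₂ (· + ·) (Finset.sum_congr rfl fun j hj => ?_) ?_
  · rw [Finset.mem_range] at hj
    unfold checkEntry
    rw [if_neg (by omega), if_pos hj, Nat.add_sub_cancel_left]
  · have h : ∀ m ∈ Finset.range (b - a),
        checkEntry b C α v (b - a + r) (τ + 1 + m) * c (τ + 1 + m) =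
          if r = 0 ∧ m + 1 = b - a then c (τ + (b - a)) else 0 := by
      intro m hm
      rw [Finset.mem_range] at hm
      unfold checkEntry
      rw [if_neg (by omega), if_neg (by omega)]
      by_cases h : r = 0 ∧ m + 1 = b - a
      · rw [if_pos h, if_pos (by omega), one_mul]
        congr 1
        omega
      · rw [if_neg h, if_neg (by omega), zero_mul]
    rw [Finset.sum_congr rfl h]
    split_ifs with h0
    · rw [Finset.sum_eq_single (b - a - 1)]
      · rw [if_pos (by omega)]
      · intro m _ hm
        rw [if_neg (by omega)]
      · intro hn
        exact absurd (Finset.mem_range.mpr (by omega)) hn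
    · symm
      refine Finset.sum_eq_zero fun m hm => ?_
      rw [Finset.mem_range] at hm
      rw [if_neg (by omega)]

theorem blockEntry_map (i j : ℕ) :
    blockEntry (C.map (algebraMap K L)) i j = algebraMap K L (blockEntry C i j) := by
  unfold blockEntry
  split_ifs <;> simp

/-- A nonzero determinant over `K` stays nonzero over `L`. The bound `δ + b ≤ e + 1` keeps the
window off the first `δ` columns, the only ones where `unitEntry` and the parity-check matrix
differ. -/
theorem SatisfiesChecks.eq_zero_of_window {c : ℕ → L} (hc : SatisfiesChecks b C α v c) {e : ℕ}
    (hw : WindowIndep b (unitEntry b C v) e) (hbe : b ≤ e + 1) (hde : b - a + b ≤ e + 1)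
    (het : e ≤ τ + (b - a))
    (hsupp : ∀ j < τ + 1 + (b - a), ¬ (e + 1 ≤ j + b ∧ j ≤ e) → c j = 0) :
    ∀ j < τ + 1 + (b - a), c j = 0 := by
  let M : Matrix (Fin b) (Fin b) K := Matrix.of fun i l => unitEntry b C v i (e + 1 - b + l)
  have hM : M.det ≠ 0 := by
    intro h0
    obtain ⟨ψ, hψ0, hψ⟩ := Matrix.exists_vecMul_eq_zero_iff.mpr h0
    apply hψ0
    have : extend ψ = 0 := by
      refine hw _ ⟨fun i hi => extend_of_le ψ (by simpa using hi), fun j hj => ?_⟩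
      rw [Finset.mem_Ico] at hj
      have h1 := congrFun hψ ⟨j - (e + 1 - b), by omega⟩
      simp only [Matrix.vecMul, dotProduct, Pi.zero_apply, M, Matrix.of_apply] at h1
      rw [show e + 1 - b + (j - (e + 1 - b)) = j by omega] at h1
      rw [Finset.sum_range]
      simpa only [extend_val] using h1
    ext i
    rw [← extend_val ψ i, this]
    rfl
  have hML : (M.map (algebraMap K L)).det ≠ 0 := by
    rw [← RingHom.mapMatrix_apply, ← RingHom.map_det]
    simpa using hM
  have hz : (fun l : Fin b => c (e + 1 - b + l)) = 0 := by
    refine Matrix.eq_zero_of_mulVec_eq_zero hML ?_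
    ext i
    have h1 := hc i i.2
    have hsub : Finset.Ico (e + 1 - b) (e + 1) ⊆ Finset.range (τ + 1 + (b - a)) := fun j hj => by
      rw [Finset.mem_Ico] at hj
      rw [Finset.mem_range]
      omega
    rw [← Finset.sum_subset hsub, Finset.sum_Ico_eq_sum_range,
      show e + 1 - (e + 1 - b) = b by omega, Finset.sum_range] at h1
    · rw [Pi.zero_apply, ← h1]
      simp only [Matrix.mulVec, dotProduct, M, Matrix.map_apply, Matrix.of_apply]
      refine Finset.sum_congr rfl fun l _ => ?_
      congr 1
      unfold unitEntry checkEntry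
      split_ifs <;> first | rfl | omega | simp
    · intro j hj hj'
      rw [Finset.mem_range] at hj
      rw [Finset.mem_Ico] at hj'
      rw [hsupp j hj (by omega), mul_zero]
  intro j hj
  by_cases h : e + 1 ≤ j + b ∧ j ≤ e
  · have := congrFun hz ⟨j - (e + 1 - b), by omega⟩
    simpa [show e + 1 - b + (j - (e + 1 - b)) = j by omega] using this
  · exact hsupp j hj h

theorem SatisfiesChecks.burst {c : ℕ → L} (hc : SatisfiesChecks b C α v c) (ha : 1 ≤ a)
    (hab : a ≤ b) (hα : α ≠ 0)
    (hw : ∀ e, b ≤ e → e ≤ τ + (b - a) → WindowIndep b (unitEntry b C v) e)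
    (hw₀ : WindowIndep b (unitEntry b C v) (b - 1))
    {i : ℕ} (hi : i < τ + 1 - a) (hbefore : ∀ j < i, c j = 0)
    (hafter : ∀ j < τ + 1 + (b - a), i + b ≤ j → j ≤ i + τ → c j = 0) : c i = 0 := by
  -- For `i < δ` the free entries of row `i` all lie in the positions after the burst that are known
  -- to vanish. For `i ≥ δ` those positions reach the end of the word.
  by_cases hid : i < b - a
  · have h := hc.upper_row hid
    rw [Finset.sum_eq_zero, add_zero] at h
    · exact (mul_eq_zero.mp h).resolve_left hα
    · intro j hj
      rw [Finset.mem_Ico] at hj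
      rw [hafter j (by omega) (by omega) (by omega), mul_zero]
  · have hwe : WindowIndep b (unitEntry b C v) (i + b - 1) := by
      rcases Nat.eq_zero_or_pos i with rfl | h
      · simpa using hw₀
      · exact hw _ (by omega) (by omega)
    refine hc.eq_zero_of_window hwe (by omega) (by omega) (by omega) (fun j hj hj' => ?_) i
      (by omega)
    by_cases hji : j < i
    · exact hbefore j hji
    · exact hafter j hj (by omega) (by omega)

theorem SatisfiesChecks.random_of_ge {c : ℕ → L} (hc : SatisfiesChecks b C α v c)
    (hC : IsCauchyLike C) (hab : a ≤ b) (hbt : b ≤ τ)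
    {i : ℕ} (hid : b - a ≤ i) (hi : i < τ + 1 - a) (hbefore : ∀ j < i, c j = 0)
    (T : Finset ℕ) (hT : ∀ j < τ + 1 + (b - a), c j ≠ 0 → j ∈ T) (hcard : T.card ≤ a) :
    c i = 0 := by
  classical
  -- Since `c 0 = 0` when `δ > 0`, the symbol at `τ + δ` can be moved to position `0`, whose column
  -- in `[I C]` is the same unit vector. The result is a codeword of the MDS code, of weight at most
  -- `a`.
  let σ : ℕ → ℕ := fun j => if 0 < b - a ∧ j = 0 then τ + (b - a) else j
  have hn : a + (τ + 1 - a) = τ + 1 := by omega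
  have hσ : ∀ j < τ + 1, σ j < τ + 1 + (b - a) := fun j hj => by
    simp only [σ]
    split_ifs <;> omega
  have key := hC.map (L := L) |>.right_kernel (Finset.range a)
    {j ∈ Finset.range (τ + 1) | c (σ j) ≠ 0} (fun i hi => Finset.mem_range.mp hi)
    (fun j => c (σ j)) (fun r hr => ?_) (fun j hj _ hne => ?_) ?_
  · have := key i (by omega) (fun h => Finset.mem_range.mpr h)
    simp only [σ] at this
    rwa [if_neg (by omega)] at this
  · rw [Finset.mem_range] at hr
    rw [← hc.lower_row hab hr, hn, Finset.sum_range_succ', Finset.sum_range_succ', add_assoc]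
    congr 1
    · refine Finset.sum_congr rfl fun j _ => ?_
      simp [σ, blockEntry_map]
    · rw [blockEntry_map, blockEntry_of_lt C (by omega)]
      by_cases hd : 0 < b - a
      · rw [hbefore 0 (by omega)]
        by_cases hr0 : r = 0 <;> simp [σ, hd, hr0]
      · simp [σ, hd]
  · simp only [Finset.mem_filter, Finset.mem_range]
    exact ⟨by omega, hne⟩
  · rw [Finset.card_range]
    refine le_trans ?_ hcard
    refine Finset.card_le_card_of_injOn σ ?_ ?_
    · intro j hj
      simp only [Finset.coe_filter, Finset.mem_range, Set.mem_ofPred_eq] at hj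
      exact hT _ (hσ j hj.1) hj.2
    · intro j hj l hl hjl
      simp only [Finset.coe_filter, Finset.mem_range, Set.mem_ofPred_eq] at hj hl
      simp only [σ] at hjl
      split_ifs at hjl <;> omega

/-- The rows of `[I C]` other than the first one give a code of minimum distance `a` on the
columns other than the first one. -/
theorem IsCauchyLike.eq_zero_of_tail_checks {F : Type*} [Field F]
    {C : Matrix (Fin a) (Fin (τ + 1 - a)) F}
    (hC : IsCauchyLike C) (ha : 1 ≤ a) (hat : a ≤ τ) (c : ℕ → F)
    (hc : ∀ r, 1 ≤ r → r < a → ∑ j ∈ Finset.range (τ + 1), blockEntry C r j * c j = 0)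
    (T : Finset ℕ) (hT : ∀ j, 1 ≤ j → j ≤ τ → c j ≠ 0 → j ∈ T) (hcard : T.card < a) :
    ∀ j, 1 ≤ j → j ≤ τ → c j = 0 := by
  intro j h1 hj
  refine hC.right_kernel (Finset.Ico 1 a) T (fun i hi => (Finset.mem_Ico.mp hi).2) c
    (fun r hr => ?_) (fun j hj hja hne => ?_) ?_ j (by omega)
    (fun h => Finset.mem_Ico.mpr ⟨h1, h⟩)
  · rw [Finset.mem_Ico] at hr
    rw [show a + (τ + 1 - a) = τ + 1 by omega]
    exact hc r hr.1 hr.2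
  · refine hT j ?_ (by omega) hne
    by_contra h
    have := hja (by omega)
    rw [Finset.mem_Ico] at this
    omega
  · simp
    omega

theorem SatisfiesChecks.random_of_lt {c : ℕ → L} (hc : SatisfiesChecks b C α v c)
    (hC : IsCauchyLike C) (ha : 1 ≤ a) (hab : a ≤ b) (hbt : b ≤ τ) (hα : α ≠ 0)
    (hα' : 1 < b - a → α ∉ Set.range (algebraMap K L))
    {i : ℕ} (hid : i < b - a) (hbefore : ∀ j < i, c j = 0)
    (T : Finset ℕ) (hT : ∀ j, i ≤ j → j ≤ i + τ → c j ≠ 0 → j ∈ T) (hcard : T.card ≤ a) :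
    c i = 0 := by
  classical
  by_contra hci
  have hiT : i ∈ T := hT i le_rfl (by omega) hci
  -- The first row of `[I C]` is left out: it may involve the symbol at `τ + δ`, which arrives after
  -- the deadline `i + τ`. The other rows do not meet column `0` either.
  have hrow : ∀ r, 1 ≤ r → r < a →
      ∑ j ∈ Finset.range (τ + 1), algebraMap K L (blockEntry C r j) * c j = 0 := by
    intro r h1 hr
    have := hc.lower_row hab hr
    rwa [if_neg (by omega), add_zero] at this
  have hge : ∀ j, c j ≠ 0 → i ≤ j := fun j hj => by
    by_contra h
    exact hj (hbefore j (by omega))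
  have small : ∀ m ∈ T, (∀ j, 1 ≤ j → j ≤ τ → c j ≠ 0 → j ≠ m) →
      ∀ j, 1 ≤ j → j ≤ τ → c j = 0 := by
    intro m hm hne
    refine (hC.map (L := L)).eq_zero_of_tail_checks ha (by omega) c ?_ (T.erase m) ?_ ?_
    · simpa only [blockEntry_map] using hrow
    · intro j h1 hj hj0
      exact Finset.mem_erase.mpr ⟨hne j h1 hj hj0, hT j (hge j hj0) (by omega) hj0⟩
    · rw [Finset.card_erase_of_mem hm]
      omega
  have hup := hc.upper_row hid
  rcases Nat.eq_zero_or_pos i with rfl | hi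
  · have h0 := small 0 hiT (fun j h1 _ _ => by omega)
    rw [Finset.sum_eq_zero, add_zero] at hup
    · exact (mul_ne_zero hα hci) hup
    · intro j hj
      rw [Finset.mem_Ico] at hj
      rw [h0 j (by omega) (by omega), mul_zero]
  · by_cases hbig : ∃ m ∈ T, τ < m
    · obtain ⟨m, hm, hmt⟩ := hbig
      -- An erasure beyond column `τ` leaves at most `a - 1` in columns `1, …, τ`, which the
      -- remaining rows correct.
      exact hci (small m hm (fun j _ hj _ => by omega) i hi (by omega))
    · push Not at hbig
      -- As `α ∉ K`, the elements `c i` and `α * c i` are independent over `K`, so a functional `f`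
      -- separates them. Applying `f` to the checks keeps their coefficients in `K` and removes
      -- position `i` from the support.
      have hnot : α * c i ∉ Submodule.span K {c i} := by
        rw [Submodule.mem_span_singleton]
        rintro ⟨x, hx⟩
        rw [Algebra.smul_def] at hx
        exact hα' (by omega) ⟨x, mul_right_cancel₀ hci hx⟩
      obtain ⟨f, hf, hfi⟩ := Submodule.exists_dual_map_eq_bot_of_notMem hnot inferInstance
      have hfi0 : f (c i) = 0 := by
        have : f (c i) ∈ (Submodule.span K {c i}).map f :=
          Submodule.mem_map_of_mem (Submodule.mem_span_singleton_self _)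
        rwa [hfi, Submodule.mem_bot] at this
      have hf_mul : ∀ (x : K) (y : L), f (algebraMap K L x * y) = x * f y := fun x y => by
        rw [← Algebra.smul_def, map_smul, smul_eq_mul]
      have hfc : ∀ j, 1 ≤ j → j ≤ τ → f (c j) = 0 := by
        refine hC.eq_zero_of_tail_checks ha (by omega) (fun j => f (c j)) ?_ (T.erase i) ?_ ?_
        · intro r h1 hr
          have := congrArg f (hrow r h1 hr)
          simpa only [map_sum, hf_mul, map_zero] using this
        · intro j h1 hj hj0
          have hcj : c j ≠ 0 := fun h => hj0 (by rw [h, map_zero])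
          refine Finset.mem_erase.mpr ⟨fun h => hj0 (by rw [h, hfi0]), ?_⟩
          exact hT j (hge j hcj) (by omega) hcj
        · rw [Finset.card_erase_of_mem hiT]
          omega
      apply hf
      have := congrArg f hup
      rw [map_add, map_sum, Finset.sum_eq_zero, add_zero, map_zero] at this
      · exact this
      · intro j hj
        rw [Finset.mem_Ico] at hj
        rw [hf_mul]
        by_cases hjt : j ≤ τ
        · rw [hfc j (by omega) hjt, mul_zero]
        · have hcj : c j = 0 := by
            by_contra h
            have := hbig j (hT j (by omega) (by omega) h)
            omega
          rw [hcj, map_zero, mul_zero]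

end Codewords

/-! ### From block codes to streaming codes -/

section DiagonalEmbedding
variable {F : Type*} [Field F] {k n r : ℕ}

/-- Restriction to the first `k` coordinates is injective on the code by `hsys`, and the code has
dimension at least `n - r = k`. Preimages of the unit vectors are the rows of `[I P]`. -/
theorem exists_systematicGenerator (H : Matrix (Fin r) (Fin n) F) (hn : n = k + r)
    (hsys : ∀ c ∈ blockCode H, (∀ j : Fin n, (j : ℕ) < k → c j = 0) → c = 0) :
    ∃ P : Matrix (Fin k) (Fin (n - k)) F,
      Submodule.span F (Set.range (systematicGenerator P).row) = blockCode H := by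
  let π : blockCode H →ₗ[F] (Fin k → F) :=
    (LinearMap.funLeft F F (Fin.castLE (show k ≤ n by omega))).comp (blockCode H).subtype
  have hπ : ∀ (c : blockCode H) (i : Fin k), π c i = c.1 (Fin.castLE (by omega) i) :=
    fun c i => rfl
  have hinj : Function.Injective π := by
    rw [← LinearMap.ker_eq_bot, LinearMap.ker_eq_bot']
    intro c hc
    ext1
    refine hsys c.1 c.2 fun j hj => ?_
    have := congrFun hc ⟨j, hj⟩
    rwa [hπ] at this
  have hdim : k ≤ Module.finrank F (blockCode H) := by
    have h1 := LinearMap.finrank_range_add_finrank_ker H.mulVecLin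
    have h2 := Submodule.finrank_le (LinearMap.range H.mulVecLin)
    simp only [Module.finrank_fintype_fun_eq_card, Fintype.card_fin] at h1 h2
    change k ≤ Module.finrank F (LinearMap.ker H.mulVecLin)
    omega
  have hsurj : Function.Surjective π := by
    rw [← LinearMap.range_eq_top]
    apply Submodule.eq_top_of_finrank_eq
    have h1 := LinearMap.finrank_range_of_inj hinj
    have h2 := Submodule.finrank_le (LinearMap.range π)
    simp only [Module.finrank_fintype_fun_eq_card, Fintype.card_fin] at h2 ⊢
    omega
  choose g hg using fun i : Fin k => hsurj (Pi.single i 1)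
  let P : Matrix (Fin k) (Fin (n - k)) F :=
    Matrix.of fun i j => (g i).1 ⟨k + j, by omega⟩
  have hrow : ∀ i, (systematicGenerator P).row i = (g i).1 := by
    intro i
    ext j
    simp only [Matrix.row, systematicGenerator, Matrix.of_apply]
    split_ifs with h
    · have := congrFun (hg i) ⟨j, h⟩
      rw [hπ] at this
      rw [Matrix.one_apply]
      simpa [Pi.single_apply, eq_comm] using this.symm
    · simp only [P, Matrix.of_apply]
      exact congrArg (g i).1 (Fin.ext (by simp only; omega))
  refine ⟨P, le_antisymm ?_ ?_⟩
  · rw [Submodule.span_le]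
    rintro _ ⟨i, rfl⟩
    rw [hrow]
    exact (g i).2
  · intro c hc
    have : (⟨c, hc⟩ : blockCode H) = ∑ i, c (Fin.castLE (by omega) i) • g i := by
      apply hinj
      rw [map_sum]
      ext l
      simp only [map_smul, hg, Finset.sum_apply, Pi.smul_apply, smul_eq_mul, Pi.single_apply,
        mul_ite, mul_one, mul_zero, Finset.sum_ite_eq, Finset.mem_univ, if_true, hπ]
    have hc' : c = ∑ i, c (Fin.castLE (by omega) i) • (g i).1 := by
      conv_lhs => rw [show c = (⟨c, hc⟩ : blockCode H).1 from rfl, this]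
      simp
    rw [hc']
    refine Submodule.sum_mem _ fun i _ => Submodule.smul_mem _ _ (Submodule.subset_span ⟨i, ?_⟩)
    exact hrow i

theorem vecMul_systematicGenerator_apply (P : Matrix (Fin k) (Fin (n - k)) F) (m : Fin k → F)
    (j : Fin n) :
    Matrix.vecMul m (systematicGenerator P) j =
      if h : (j : ℕ) < k then m ⟨j, h⟩
      else ∑ i, m i * P i ⟨(j : ℕ) - k, by have := j.isLt; omega⟩ := by
  simp only [Matrix.vecMul, dotProduct, systematicGenerator, Matrix.of_apply]
  split_ifs with h
  · simp [Matrix.one_apply]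
  · rfl

theorem vecMul_mem_span_row (G : Matrix (Fin k) (Fin n) F) (m : Fin k → F) :
    Matrix.vecMul m G ∈ Submodule.span F (Set.range G.row) := by
  rw [Matrix.vecMul_eq_sum]
  exact Submodule.sum_mem _ fun i _ => Submodule.smul_mem _ _ (Submodule.subset_span ⟨i, rfl⟩)

/-- The message symbols on the diagonal which passes through position `i` at time `t`. -/
def diagonalMessage (d : ℕ → Fin k → F) (t i : ℕ) (l : Fin k) : F :=
  if i ≤ t + l then d (t + l - i) l else 0

/-- Differences of coded symbols along a diagonal form one codeword, also when the diagonal starts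
before time `0`, as missing message symbols count as zero. -/
theorem StreamingCode.codedPacket_sub (S : StreamingCode F k n)
    {P : Matrix (Fin k) (Fin (n - k)) F}
    (hS : ∀ (t : ℕ) (s : Fin (t + 1) → Fin k → F) (j : Fin (n - k)),
        S.parity t s j = ∑ i : Fin k,
          (if (j : ℕ) + k ≤ t + i then
            s ⟨t + i - (j + k), by have := i.isLt; omega⟩ i else 0) * P i j)
    (s s' : ℕ → Fin k → F) (t i : ℕ) (j : Fin n) (hij : i ≤ j) :
    S.codedPacket s (t + j - i) j - S.codedPacket s' (t + j - i) j =
      Matrix.vecMul (diagonalMessage (s - s') t i) (systematicGenerator P) j := by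
  rw [vecMul_systematicGenerator_apply]
  unfold StreamingCode.codedPacket
  split_ifs with h
  · simp [diagonalMessage, show i ≤ t + j by omega]
  · rw [hS, hS, ← Finset.sum_sub_distrib]
    refine Finset.sum_congr rfl fun l _ => ?_
    rw [← sub_mul]
    congr 1
    unfold diagonalMessage
    by_cases hl : i ≤ t + l
    · rw [if_pos (by simp only; omega), if_pos (by simp only; omega), if_pos hl]
      simp only [Pi.sub_apply]
      rw [show t + (j : ℕ) - i + (l : ℕ) - ((j : ℕ) - k + k) = t + l - i by omega]
    · rw [if_neg (by simp only; omega), if_neg (by simp only; omega), if_neg hl, sub_zero]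

/-- A code whose codewords can be decoded, symbol by symbol and with delay `τ`, from bursts of
length `b` and from `a` arbitrary erasures yields a streaming code for the sliding-window
channel. -/
theorem StreamingCode.recovers_of_diagonal (S : StreamingCode F k n)
    {P : Matrix (Fin k) (Fin (n - k)) F} {D : Submodule F (Fin n → F)}
    (hD : Submodule.span F (Set.range (systematicGenerator P).row) = D)
    (hS : ∀ (t : ℕ) (s : Fin (t + 1) → Fin k → F) (j : Fin (n - k)),
        S.parity t s j = ∑ i : Fin k,
          (if (j : ℕ) + k ≤ t + i then
            s ⟨t + i - (j + k), by have := i.isLt; omega⟩ i else 0) * P i j)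
    {a b τ : ℕ}
    (hburst : ∀ c ∈ D, ∀ i : Fin n, (i : ℕ) < k → (∀ j < i, c j = 0) →
      (∀ j : Fin n, (i : ℕ) + b ≤ j → (j : ℕ) ≤ i + τ → c j = 0) → c i = 0)
    (hrandom : ∀ c ∈ D, ∀ i : Fin n, (i : ℕ) < k → (∀ j < i, c j = 0) →
      {j : Fin n | i ≤ j ∧ (j : ℕ) ≤ i + τ ∧ c j ≠ 0}.ncard ≤ a → c i = 0) :
    S.Recovers a b τ (τ + 1) := by
  classical
  -- Unique decodability: agreeing receptions up to `t + τ` force equal messages at `t`. By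
  -- induction earlier messages agree, so the diagonal through symbol `i` at time `t` gives a
  -- codeword vanishing before `i`.
  have key : ∀ (s s' : ℕ → Fin k → F) (E E' : Set ℕ), SWAdmissible a b (τ + 1) E →
      ∀ t, (∀ u ≤ t + τ, S.received E s u = S.received E' s' u) → s t = s' t := by
    intro s s' E E' hE t
    induction t using Nat.strong_induction_on with
    | _ t ih =>
      intro hrec
      have hprev : ∀ u < t, s u = s' u := fun u hu =>
        ih u hu fun u' hu' => hrec u' (by omega)
      have hpacket : ∀ u ≤ t + τ, u ∉ E → S.codedPacket s u = S.codedPacket s' u := by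
        intro u hu huE
        have h := hrec u hu
        unfold StreamingCode.received at h
        rw [if_neg huE] at h
        split_ifs at h
        exact Option.some.inj h
      ext i
      have hkn := S.k_lt_n
      let p : Fin n := ⟨i, by omega⟩
      let c := Matrix.vecMul (diagonalMessage (s - s') t i) (systematicGenerator P)
      have hcD : c ∈ D := hD ▸ vecMul_mem_span_row _ _
      have hcp : c p = s t i - s' t i := by
        simp [c, p, vecMul_systematicGenerator_apply, diagonalMessage]
      have hbefore : ∀ j < p, c j = 0 := by
        intro j hj
        have hji : (j : ℕ) < i := hj
        simp only [c, vecMul_systematicGenerator_apply]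
        rw [dif_pos (by omega)]
        unfold diagonalMessage
        split_ifs with h
        · simp only at h ⊢
          rw [Pi.sub_apply, hprev _ (by omega), sub_self]
          rfl
        · rfl
      have herased : ∀ j : Fin n, p ≤ j → (j : ℕ) ≤ i + τ → c j ≠ 0 → t + j - i ∈ E := by
        intro j hpj hjτ hj
        by_contra hE
        have hpj' : (i : ℕ) ≤ j := hpj
        apply hj
        simp only [c]
        rw [← S.codedPacket_sub hS s s' t i j hpj', hpacket _ (by omega) hE, sub_self]
      suffices h : c p = 0 from sub_eq_zero.mp (hcp ▸ h)
      by_contra hne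
      -- The window of length `τ + 1` starting at `t` is exactly the span of positions `i, …, i + τ`
      -- on this diagonal.
      rcases hE t with ⟨j₀, l, hl, hburstE⟩ | hncard
      · refine hne (hburst c hcD p i.2 hbefore fun j hjb hjτ => ?_)
        by_contra hj
        have hpj : (i : ℕ) + b ≤ j := hjb
        have hjτ' : (j : ℕ) ≤ i + τ := hjτ
        have h1 : t ∈ Set.Ico j₀ (j₀ + l) := by
          rw [← hburstE]
          have := herased p le_rfl (by simp [p]) hne
          simp only [p, Nat.add_sub_cancel] at this
          exact ⟨this, by simp⟩
        have h2 : t + j - i ∈ Set.Ico j₀ (j₀ + l) := by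
          rw [← hburstE]
          refine ⟨herased j (show (i : ℕ) ≤ j by omega) hjτ' hj, ?_⟩
          rw [Set.mem_Ico]
          omega
        rw [Set.mem_Ico] at h1 h2
        omega
      · refine hne (hrandom c hcD p i.2 hbefore (le_trans ?_ hncard))
        refine Set.ncard_le_ncard_of_injOn (fun j : Fin n => t + (j : ℕ) - i) ?_ ?_
          ((Set.finite_Ico _ _).subset Set.inter_subset_right)
        · rintro j ⟨hpj, hjτ, hj⟩
          have hpj' : (i : ℕ) ≤ j := hpj
          have hjτ' : (j : ℕ) ≤ i + τ := hjτ
          refine ⟨herased j hpj hjτ' hj, ?_⟩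
          rw [Set.mem_Ico]
          omega
        · rintro j ⟨hpj, -⟩ j' ⟨hpj', -⟩ h
          have h1 : (i : ℕ) ≤ j := hpj
          have h2 : (i : ℕ) ≤ j' := hpj'
          simp only at h
          ext
          omega
  -- The decoder outputs the message of any sequence consistent with the reception; by `key` the
  -- choice is irrelevant.
  refine ⟨fun t y => if h : ∃ (s : ℕ → Fin k → F) (E : Set ℕ), SWAdmissible a b (τ + 1) E ∧
    ∀ u : Fin (t + τ + 1), S.received E s u = y u then h.choose t else 0, ?_⟩
  intro s E hE t
  have h : ∃ (s' : ℕ → Fin k → F) (E' : Set ℕ), SWAdmissible a b (τ + 1) E' ∧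
      ∀ u : Fin (t + τ + 1), S.received E' s' u = S.received E s u := ⟨s, E, hE, fun _ => rfl⟩
  beta_reduce
  rw [dif_pos h]
  obtain ⟨E', hE', hrec⟩ := h.choose_spec
  exact key _ s E' E hE' t fun u hu => hrec ⟨u, by omega⟩

end DiagonalEmbedding

/-! ### Assembling the construction and choosing the fields -/

section Construction
variable {K L : Type*} [Field K] [Field L] [Algebra K L] {a b τ : ℕ}

theorem yieldsRateOptimal_of_windowIndep {C : Matrix (Fin a) (Fin (τ + 1 - a)) K}
    (hC : IsCauchyLike C) (ha : 1 ≤ a) (hab : a ≤ b) (hbt : b ≤ τ) {α : L} (hα : α ≠ 0)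
    (hα' : 1 < b - a → α ∉ Set.range (algebraMap K L)) {v : ℕ → ℕ → K}
    (hw : ∀ e, b ≤ e → e ≤ τ + (b - a) → WindowIndep b (unitEntry b C v) e) :
    YieldsRateOptimal a b τ (constructionA a b τ C α v) := by
  classical
  have hat : a ≤ τ := hab.trans hbt
  -- The last window consists of the `b = n - k` parity columns; its independence makes the first
  -- `k` coordinates an information set.
  obtain ⟨P, hP⟩ := exists_systematicGenerator (k := τ + 1 - a) (constructionA a b τ C α v)
    (by omega) (fun c hc h => by
      have hz := (satisfiesChecks_of_mem hat hc).eq_zero_of_window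
        (hw (τ + (b - a)) (by omega) le_rfl) (by omega) (by omega) le_rfl (fun j hj hj' => by
          rw [extend, dif_pos hj]
          exact h ⟨j, hj⟩ (by simp only; omega))
      ext j
      rw [← extend_val c j, hz j j.2]
      rfl)
  let S : StreamingCode L (τ + 1 - a) (τ + 1 + (b - a)) :=
    { k_lt_n := by omega
      parity := fun t s j => ∑ i : Fin (τ + 1 - a),
          (if (j : ℕ) + (τ + 1 - a) ≤ t + i then
            s ⟨t + i - (j + (τ + 1 - a)), by have := i.isLt; omega⟩ i else 0) * P i j }
  have h1 : ((τ + 1 - a : ℕ) : ℚ) = τ - a + 1 := by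
    rw [Nat.cast_sub (by omega)]
    push_cast
    ring
  have h2 : ((τ + 1 + (b - a) : ℕ) : ℚ) = τ + (b - a) + 1 := by
    push_cast [Nat.cast_sub hab]
    ring
  refine ⟨S, ⟨P, hP, fun t s j => rfl⟩, ⟨?_, ?_⟩, ?_⟩
  · rw [StreamingCode.rate, h1, h2]
    simp
  · refine S.recovers_of_diagonal hP (fun t s j => rfl) ?_ ?_
    · intro c hc i hi hbefore hafter
      rw [← extend_val c i]
      refine (satisfiesChecks_of_mem hat hc).burst ha hab hα hw
        (windowIndep_first hC ha hab hbt) hi (fun j hj => ?_) (fun j hj hjb hjτ => ?_)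
      · rw [extend, dif_pos (by omega)]
        exact hbefore _ hj
      · rw [extend, dif_pos hj]
        exact hafter _ hjb hjτ
    · intro c hc i hi hbefore hcard
      have hc' := satisfiesChecks_of_mem hat hc
      have hbefore' : ∀ j < (i : ℕ), extend c j = 0 := fun j hj => by
        rw [extend, dif_pos (by omega)]
        exact hbefore _ hj
      rw [Set.ncard_eq_toFinset_card'] at hcard
      set T := ({j : Fin (τ + 1 + (b - a)) | i ≤ j ∧ (j : ℕ) ≤ i + τ ∧ c j ≠ 0} : Set _).toFinset
      have hT : ∀ j, (i : ℕ) ≤ j → j ≤ i + τ → extend c j ≠ 0 → j ∈ T.map Fin.valEmbedding := by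
        intro j hij hj hne
        have hjn : j < τ + 1 + (b - a) := by
          by_contra h
          exact hne (extend_of_le c (by omega))
        rw [extend, dif_pos hjn] at hne
        rw [Finset.mem_map]
        exact ⟨⟨j, hjn⟩, by simpa [T] using ⟨hij, hj, hne⟩, rfl⟩
      rw [← extend_val c i]
      by_cases hid : (i : ℕ) < b - a
      · exact hc'.random_of_lt hC ha hab hbt hα hα' hid hbefore' _ hT (by rwa [Finset.card_map])
      · refine hc'.random_of_ge hC hab hbt (by omega) hi hbefore'
          (T.map Fin.valEmbedding) (fun j hj hne => ?_)
          (by rwa [Finset.card_map])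
        refine hT j ?_ (by omega) hne
        by_contra h
        exact hne (hbefore' j (by omega))
  · rw [StreamingCode.rate, h1, h2]
    congr 1
    ring

theorem exists_yieldsRateOptimal [Finite K] (ha : 1 ≤ a) (hab : a ≤ b) (hbt : b ≤ τ)
    (hK : τ + 1 ≤ Nat.card K) {C : Matrix (Fin a) (Fin (τ + 1 - a)) K} (hC : IsCauchyLike C)
    {α : L} (hα : α ≠ 0) (hα' : 1 < b - a → α ∉ Set.range (algebraMap K L)) :
    ∃ v : ℕ → ℕ → K, YieldsRateOptimal a b τ (constructionA a b τ C α v) := by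
  obtain ⟨v, hv⟩ := exists_windowIndep hC ha hab hbt hK
  exact ⟨v, yieldsRateOptimal_of_windowIndep hC ha hab hbt hα hα' hv⟩

theorem exists_isCauchyLike_cauchyMatrix [Finite K] (hat : a ≤ τ) (hK : τ + 1 ≤ Nat.card K) :
    ∃ (x : Fin a → K) (y : Fin (τ + 1 - a) → K), Function.Injective (Sum.elim x y) ∧
      IsCauchyLike (cauchyMatrix x y) := by
  have := Fintype.ofFinite K
  obtain ⟨f⟩ : Nonempty (Fin a ⊕ Fin (τ + 1 - a) ↪ K) := by
    apply Function.Embedding.nonempty_of_card_le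
    rw [Nat.card_eq_fintype_card] at hK
    simp only [Fintype.card_sum, Fintype.card_fin]
    omega
  have h : Function.Injective (Sum.elim (f ∘ Sum.inl) (f ∘ Sum.inr)) := by
    rw [Sum.elim_comp_inl_inr]
    exact f.injective
  exact ⟨_, _, h, isCauchyLike_cauchyMatrix _ _ h⟩

theorem exists_notMem_range_algebraMap (h : Module.finrank K L = 2) :
    ∃ α : L, α ∉ Set.range (algebraMap K L) := by
  by_contra! hα
  have htop : (⊥ : Subalgebra K L) = ⊤ := by
    rw [eq_top_iff]
    intro x _
    exact Algebra.mem_bot.mpr (hα x)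
  have := Subalgebra.bot_eq_top_iff_finrank_eq_one.mp htop
  omega

/-- There is a finite field whose order is a power of two between `τ + 1` and `2 τ`. -/
theorem exists_galoisField_card_between (hτ : 1 ≤ τ) :
    ∃ s : ℕ, s ≠ 0 ∧ τ + 1 ≤ Nat.card (GaloisField 2 s) ∧ Nat.card (GaloisField 2 s) ≤ 2 * τ := by
  refine ⟨Nat.log 2 τ + 1, by omega, ?_⟩
  rw [GaloisField.card 2 _ (by omega)]
  have h1 := Nat.lt_pow_succ_log_self one_lt_two τ
  have h2 := Nat.pow_log_le_self 2 (show τ ≠ 0 by omega)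
  rw [pow_succ] at *
  omega

end Construction

end Streaming

/-! ### The main theorem -/

theorem theorem1 :
    -- a Cauchy block exists as soon as `q ≥ τ + 1`
    (∀ (K : Type*) [Field K] [Finite K] (a b τ : ℕ), 1 ≤ a → a ≤ b → b ≤ τ → τ + 1 ≤ Nat.card K →
      ∃ (x : Fin a → K) (y : Fin (τ + 1 - a) → K), Function.Injective (Sum.elim x y) ∧
        Streaming.IsCauchyLike (Streaming.cauchyMatrix x y)) ∧
    -- the construction over `F_{q^2}`
    (∀ (K L : Type*) [Field K] [Finite K] [Field L] [Algebra K L], Module.finrank K L = 2 →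
      ∀ a b τ : ℕ, 1 ≤ a → a ≤ b → b ≤ τ → τ + 1 ≤ Nat.card K →
        ∀ C : Matrix (Fin a) (Fin (τ + 1 - a)) K, Streaming.IsCauchyLike C →
          ∀ α : L, α ∉ Set.range (algebraMap K L) →
            ∃ v : ℕ → ℕ → K,
              Streaming.YieldsRateOptimal a b τ (Streaming.constructionA a b τ C α v)) ∧
    -- for `b - a = 1` the construction works over `F_q`, with any nonzero `α` in `F_q`
    (∀ (K : Type*) [Field K] [Finite K] (a b τ : ℕ), 1 ≤ a → b = a + 1 → b ≤ τ →
      τ + 1 ≤ Nat.card K →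
        ∀ C : Matrix (Fin a) (Fin (τ + 1 - a)) K, Streaming.IsCauchyLike C →
          ∀ α : K, α ≠ 0 →
            ∃ v : ℕ → ℕ → K,
              Streaming.YieldsRateOptimal a b τ (Streaming.constructionA a b τ C α v)) ∧
    -- the field size is `O(τ ^ 2)`
    (∃ c : ℕ, ∀ a b τ : ℕ, 1 ≤ a → a ≤ b → b ≤ τ →
      ∃ (K L : Type) (_ : Field K) (_ : Finite K) (_ : Field L) (_ : Finite L) (_ : Algebra K L),
        Module.finrank K L = 2 ∧ τ + 1 ≤ Nat.card K ∧ Nat.card L ≤ c * τ ^ 2 ∧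
          ∃ (C : Matrix (Fin a) (Fin (τ + 1 - a)) K) (α : L) (v : ℕ → ℕ → K),
            Streaming.IsCauchyLike C ∧ α ∉ Set.range (algebraMap K L) ∧
              Streaming.YieldsRateOptimal a b τ (Streaming.constructionA a b τ C α v)) ∧
    -- the field size is `O(τ)` for `b - a = 1`
    (∃ c : ℕ, ∀ a b τ : ℕ, 1 ≤ a → b = a + 1 → b ≤ τ →
      ∃ (K : Type) (_ : Field K) (_ : Finite K),
        τ + 1 ≤ Nat.card K ∧ Nat.card K ≤ c * τ ∧
          ∃ (C : Matrix (Fin a) (Fin (τ + 1 - a)) K) (α : K) (v : ℕ → ℕ → K),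
            Streaming.IsCauchyLike C ∧ α ≠ 0 ∧
              Streaming.YieldsRateOptimal a b τ (Streaming.constructionA a b τ C α v)) := by
  -- A power of two `q` with `τ < q ≤ 2 * τ` gives the constants: `q ^ 2 ≤ 4 * τ ^ 2`, and `q ≤ 2 *
  -- τ` for `b - a = 1`.
  refine ⟨?_, ?_, ?_, ⟨4, ?_⟩, ⟨2, ?_⟩⟩
  · intro K _ _ a b τ _ hab hbt hK
    exact Streaming.exists_isCauchyLike_cauchyMatrix (hab.trans hbt) hK
  · intro K L _ _ _ _ _ a b τ ha hab hbt hK C hC α hα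
    refine Streaming.exists_yieldsRateOptimal ha hab hbt hK hC ?_ (fun _ => hα)
    rintro rfl
    exact hα ⟨0, map_zero _⟩
  · intro K _ _ a b τ ha hab hbt hK C hC α hα
    exact Streaming.exists_yieldsRateOptimal ha (by omega) hbt hK hC hα (fun _ => by omega)
  · intro a b τ ha hab hbt
    obtain ⟨s, hs, hK, hK'⟩ := Streaming.exists_galoisField_card_between (τ := τ) (by omega)
    have hrank : Module.finrank (GaloisField 2 s)
        (FiniteField.Extension (GaloisField 2 s) 2 2) = 2 :=
      FiniteField.finrank_extension _ 2 2
    have hL : Nat.card (FiniteField.Extension (GaloisField 2 s) 2 2) =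
        Nat.card (GaloisField 2 s) ^ 2 := FiniteField.natCard_extension _ 2 2
    obtain ⟨x, y, -, hC⟩ := Streaming.exists_isCauchyLike_cauchyMatrix (hab.trans hbt) hK
    obtain ⟨α, hα⟩ := Streaming.exists_notMem_range_algebraMap hrank
    obtain ⟨v, hv⟩ := Streaming.exists_yieldsRateOptimal ha hab hbt hK hC
      (by rintro rfl; exact hα ⟨0, map_zero _⟩) (fun _ => hα)
    refine ⟨GaloisField 2 s, FiniteField.Extension (GaloisField 2 s) 2 2, inferInstance,
      inferInstance, inferInstance, ?_, inferInstance, hrank, hK, ?_, _, α, v, hC, hα, hv⟩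
    · exact Module.finite_of_finite (GaloisField 2 s)
    · rw [hL]
      calc Nat.card (GaloisField 2 s) ^ 2 ≤ (2 * τ) ^ 2 := Nat.pow_le_pow_left hK' 2
        _ = 4 * τ ^ 2 := by ring
  · intro a b τ ha hab hbt
    obtain ⟨s, hs, hK, hK'⟩ := Streaming.exists_galoisField_card_between (τ := τ) (by omega)
    obtain ⟨x, y, -, hC⟩ :=
      Streaming.exists_isCauchyLike_cauchyMatrix (a := a) (by omega) hK
    obtain ⟨v, hv⟩ := Streaming.exists_yieldsRateOptimal (L := GaloisField 2 s) ha
      (by omega : a ≤ b) hbt hK hC one_ne_zero (fun _ => by omega)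
    exact ⟨GaloisField 2 s, inferInstance, inferInstance, hK, hK', _, 1, v, hC, one_ne_zero, hv⟩
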